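/- \textbf{Setting.} Terms are those of the untyped call-by-value $\lambda$-calculus up to renaming of bound variables: values $V ::= x \mid \lambda x.M$, terms $M ::= V \mid M\,N$, evaluation contexts $E ::= [\cdot] \mid V\,E \mid E\,M$, with reduction $\to$ generated by $(\lambda x.M)V\to M\{V/x\}$ and closure under evaluation contexts. Names are variables $x,y,\dots$ and continuation names $p,q,\dots$ (two disjoint infinite sorts). An environment $\gamma$ is a finite partial map sending variables to values and continuation names to pairs $(E,q)$; its continuation structure is $\mathrm{cs}(\gamma)=\{(p,q)\mid \gamma(p)=(E,q)\text{ for some }E\}$. \textbf{Actions.} Player answers $\bar p(x)$ and Opponent answers $p(x)$ (binding $x$), Player questions $\bar x(y,q)$ and Opponent questions $x(y,p)$ (binding $y$ and the continuation name), and initial Opponent questions $(p)$ (binding $p$). A trace $s$ is a finite sequence of actions, and $K\Rightarrow^s$ means that $K$ can perform $s$, with silent steps interleaved. An answer in $s$ is unjustified if its subject is not bound in $s$; a question in $s$ is answered if the continuation name that it binds is the subject of an answer in $s$. \textbf{Configurations.} A configuration of Alternating OGS is active, $\langle M,p,\gamma,\phi\rangle$, or passive, $\langle\gamma,\phi\rangle$,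 or initial, $[\phi\mid M]$, where $\phi$ is a finite set of names. Its transitions, in which all bound names are fresh, i.e. outside $\phi$, and are added to $\phi$, are: \begin{itemize} \item $\langle M,p,\gamma,\phi\rangle\xrightarrow{\tau}\langle N,p,\gamma,\phi\rangle$ if $M\to N$; \item $\langle V,p,\gamma,\phi\rangle\xrightarrow{\bar p(x)}\langle\gamma\cdot[x\mapsto V],\phi\uplus\{x\}\rangle$; \item $\langle E[xV],p,\gamma,\phi\rangle\xrightarrow{\bar x(y,q)}\langle\gamma\cdot[y\mapsto V]\cdot[q\mapsto(E,p)],\phi\uplus\{y,q\}\rangle$; \item $\langle\gamma\cdot[q\mapsto(E,p)],\phi\rangle\xrightarrow{q(x)}\langle E[x],p,\gamma,\phi\uplus\{x\}\rangle$; \item $\langle\gamma,\phi\rangle\xrightarrow{x(y,p)}\langle Vy,p,\gamma,\phi\uplus\{y,p\}\rangle$ if $\gamma(x)=V$; \item $[\phi\mid M]\xrightarrow{(p)}\langle M,p,\emptyset,\phi\uplus\{p\}\rangle$. \end{itemize} Concurrent OGS has the same rules, except that $M,p$ is replaced by a finite partial map $A$ from continuation names to terms (the running terms), any of which may move, and that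 Opponent may move even when $A\neq\emptyset$ (an Opponent answer that resumes a continuation returning to $q$ requires $q\notin\mathrm{dom}\,A$); Alternating configurations are regarded as Concurrent ones with $A=\{p\mapsto M\}$ or $A=\emptyset$, and initial configurations are common to both. Well-Bracketed OGS (WB-OGS) works on stacked configurations, i.e. Alternating configurations with an additional stack $\sigma$ of continuation names (empty for initial configurations and after the initial question); Player questions push the continuation name that they bind, Opponent answers are allowed only on the top of the stack, which they pop, and the other rules leave the stack unchanged. For a stacked configuration $\mathbf F$, $\lfloor\mathbf F\rfloor$ is the Alternating configuration obtained by removing the stack. The \emph{pending} continuation names of a configuration are $p$ for each term running at $p$, and both $p$ and $q$ for each pair $(p,q)\in\mathrm{cs}(\gamma)$, counted with multiplicity. P-names are the names in $\mathrm{dom}\,\gamma$ (in Concurrent OGS also those in $\mathrm{dom}\,A$); O-names are the other names of $\phi$ that are variables or pending continuation names. This defines the polarity function. Configurations are always assumed \emph{valid}: $\mathrm{dom}\,\gamma\subseteq\phi$; the names in the image of $\gamma$, the free variables of $M$, and the toplevel continuation name $p$ are O-names; for an initial configuration $\phi$ consists of variables; and the stack of a stacked configuration lists exactly the continuation names in $\mathrm{dom}\,\gamma$,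 each once. Two configurations are \emph{support-equivalent} if they have the same polarity function, the same continuation names of running terms and the same $\mathrm{cs}(\gamma)$; for stacked ones, also the same stack. \textbf{Complete traces.} A trace $s$ is \emph{complete} for an Alternating (respectively Concurrent) configuration $F$ if $F\Rightarrow^s$ in the respective transition system, every question of $s$ is answered in $s$, and the subjects of the unjustified answers of $s$ are exactly the pending continuation names of $F$, with multiplicity. It is complete for a stacked configuration $\mathbf F$ with stack $\sigma$ if $\mathbf F\Rightarrow^s$ in WB-OGS, $s$ is well-bracketed from $\sigma$ to the empty stack (Player questions push the continuation name they bind, Opponent answers pop their subject, other actions leave the stack unchanged), and $s$ answers all its questions and exactly the pending continuation names of $\lfloor\mathbf F\rfloor$, as above. Two configurations are \emph{complete-trace equivalent} in a given OGS if they are support-equivalent and have the same complete traces in it (among the traces whose bound names are fresh for both). Write $\simeq_{\mathrm{WB}}$, $\simeq_{\mathrm A}$, $\simeq_{\mathrm C}$ for these equivalences in WB-OGS, Alternating OGS and Concurrent OGS. \textbf{Theorem.} For all stacked configurations $\mathbf F,\mathbf G$ with the same stack, \[\mathbf F\simeq_{\mathrm{WB}}\mathbf G\iff\lfloor\mathbf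 F\rfloor\simeq_{\mathrm A}\lfloor\mathbf G\rfloor\iff\lfloor\mathbf F\rfloor\simeq_{\mathrm C}\lfloor\mathbf G\rfloor .\] -/

import Mathlib

namespace OGS

/-! Names: variables and continuation names, two disjoint countably infinite sorts. -/

abbrev Var := ℕ
abbrev Cont := ℕ

inductive Name where
  | var (x : Var) : Name
  | cont (p : Cont) : Name
  deriving DecidableEq

/-! The untyped call-by-value lambda-calculus. Free variables are names, bound variables are
well-scoped de Bruijn indices: the terms of the calculus up to renaming of bound variables are
the elements of `Tm 0`. -/

inductive Tm : ℕ → Type where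
  | fvar {n : ℕ} (x : Var) : Tm n
  | bvar {n : ℕ} (i : Fin n) : Tm n
  | lam {n : ℕ} (M : Tm (n + 1)) : Tm n
  | app {n : ℕ} (M N : Tm n) : Tm n

/-- Free variables. -/
def Tm.fv : {n : ℕ} → Tm n → Finset Var
  | _, .fvar x => {x}
  | _, .bvar _ => ∅
  | _, .lam M => M.fv
  | _, .app M N => M.fv ∪ N.fv

/-- Values: variables and abstractions. -/
def Tm.IsValue : {n : ℕ} → Tm n → Prop
  | _, .fvar _ => True
  | _, .bvar _ => False
  | _, .lam _ => True
  | _, .app _ _ => False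

/-- View a term in a larger scope (the added indices are the outermost ones). -/
def Tm.lift : {n : ℕ} → Tm n → (m : ℕ) → n ≤ m → Tm m
  | _, .fvar x, _, _ => .fvar x
  | _, .bvar i, _, h => .bvar (Fin.castLE h i)
  | _, .lam M, m, h => .lam (M.lift (m + 1) (Nat.succ_le_succ h))
  | _, .app M N, m, h => .app (M.lift m h) (N.lift m h)

/-- `M.inst V` substitutes `V` for the outermost index of `M`. For `M : Tm 1` this is the substitution used in
the contraction of `(lam M) V`. -/
def Tm.inst : {n : ℕ} → Tm (n + 1) → Tm 0 → Tm n
  | _, .fvar x, _ => .fvar x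
  | n, .bvar i, V => if h : i.val < n then .bvar ⟨i.val, h⟩ else V.lift n (Nat.zero_le n)
  | _, .lam M, V => .lam (M.inst V)
  | _, .app M N, V => .app (M.inst V) (N.inst V)

abbrev Val := {V : Tm 0 // V.IsValue}

/-- Evaluation contexts `E ::= [] | V E | E M`. -/
inductive ECtx where
  | hole : ECtx
  | appR (V : Val) (E : ECtx) : ECtx
  | appL (E : ECtx) (M : Tm 0) : ECtx

def ECtx.plug : ECtx → Tm 0 → Tm 0
  | .hole, M => M
  | .appR V E, M => .app V.1 (E.plug M)
  | .appL E N, M => .app (E.plug M) N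

def ECtx.fv : ECtx → Finset Var
  | .hole => ∅
  | .appR V E => V.1.fv ∪ E.fv
  | .appL E M => E.fv ∪ M.fv

/-- Call-by-value reduction. -/
inductive Red : Tm 0 → Tm 0 → Prop where
  | beta (M : Tm 1) (V : Val) : Red (.app (.lam M) V.1) (M.inst V.1)
  | ctx (E : ECtx) {M N : Tm 0} : Red M N → Red (E.plug M) (E.plug N)

/-! Environments. Finiteness of the domain is part of validity of configurations (the domain is
contained in a finite name-support). -/

@[ext]
structure Env where
  val : Var → Option Val
  cont : Cont → Option (ECtx × Cont)

namespace Env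

def empty : Env := ⟨fun _ => none, fun _ => none⟩

def setVal (γ : Env) (x : Var) (V : Val) : Env :=
  ⟨Function.update γ.val x (some V), γ.cont⟩

def setCont (γ : Env) (q : Cont) (E : ECtx) (p : Cont) : Env :=
  ⟨γ.val, Function.update γ.cont q (some (E, p))⟩

def eraseCont (γ : Env) (q : Cont) : Env :=
  ⟨γ.val, Function.update γ.cont q none⟩

/-- The names in the domain. -/
def dom (γ : Env) : Set Name :=
  {a | (∃ x V, a = .var x ∧ γ.val x = some V) ∨ ∃ p r, a = .cont p ∧ γ.cont p = some r}

/-- The continuation structure. -/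
def cs (γ : Env) : Set (Cont × Cont) :=
  {r | ∃ E, γ.cont r.1 = some (E, r.2)}

/-- The names appearing in the images. -/
def imageNames (γ : Env) : Set Name :=
  {a | (∃ x V y, γ.val x = some V ∧ y ∈ V.1.fv ∧ a = .var y) ∨
    ∃ q E p, γ.cont q = some (E, p) ∧ ((∃ y ∈ E.fv, a = .var y) ∨ a = .cont p)}

end Env

/-! Actions and traces. -/

inductive Action where
  /-- player answer, binding `x` -/
  | ansP (p : Cont) (x : Var) : Action
  /-- opponent answer, binding `x` -/
  | ansO (p : Cont) (x : Var) : Action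
  /-- player question on `x`, binding `y` and `p` -/
  | questP (x : Var) (y : Var) (p : Cont) : Action
  /-- opponent question on `x`, binding `y` and `p` -/
  | questO (x : Var) (y : Var) (p : Cont) : Action
  /-- initial opponent question, binding `p` -/
  | init (p : Cont) : Action

/-- The bound names of an action. -/
def Action.bound : Action → List Name
  | .ansP _ x => [.var x]
  | .ansO _ x => [.var x]
  | .questP _ y p => [.var y, .cont p]
  | .questO _ y p => [.var y, .cont p]
  | .init p => [.cont p]

/-- The continuation name introduced by a question. -/
def Action.introduced : Action → List Cont
  | .ansP _ _ => []
  | .ansO _ _ => []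
  | .questP _ _ p => [p]
  | .questO _ _ p => [p]
  | .init p => [p]

/-- The subject of an answer. -/
def Action.answered : Action → List Cont
  | .ansP p _ => [p]
  | .ansO p _ => [p]
  | .questP _ _ _ => []
  | .questO _ _ _ => []
  | .init _ => []

abbrev Trace := List Action

namespace Trace

def bound (s : Trace) : List Name := s.flatMap Action.bound

def introduced (s : Trace) : List Cont := s.flatMap Action.introduced

/-- The subjects of the answers, in order. -/
def answered (s : Trace) : List Cont := s.flatMap Action.answered

/-- The subjects of the unjustified answers. Bound names are fresh in the traces of the transition
systems below, so an answer is justified iff its subject is bound anywhere in the trace. -/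
def unjustified (s : Trace) : List Cont :=
  s.answered.filter (fun p => p ∉ s.introduced)

/-- All questions of `s` are answered in `s`, and the unjustified answers of `s` are exactly
answers to the pending continuation names, where `pend p` is the number of answers on `p` that
are pending at the start. -/
def AnswersAll (s : Trace) (pend : Cont → ℕ) : Prop :=
  (∀ p ∈ s.introduced, p ∈ s.answered) ∧ ∀ p, s.unjustified.count p = pend p

end Trace

/-! Weak transitions of a labelled transition system; the label `none` is the silent action. -/

section Weak

def TauStar {S : Type} (step : S → Option Action → S → Prop) : S → S → Prop :=
  Relation.ReflTransGen (fun K K' => step K none K')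

def WeakStep {S : Type} (step : S → Option Action → S → Prop) (K : S) (l : Action) (K' : S) :
    Prop :=
  ∃ K₁ K₂, TauStar step K K₁ ∧ step K₁ (some l) K₂ ∧ TauStar step K₂ K'

def WeakTrace {S : Type} (step : S → Option Action → S → Prop) : S → Trace → S → Prop
  | K, [], K' => K = K'
  | K, l :: s, K' => ∃ K₁, WeakStep step K l K₁ ∧ WeakTrace step K₁ s K'

/-- The traces of a state. -/
def HasTrace {S : Type} (step : S → Option Action → S → Prop) (K : S) (s : Trace) : Prop :=
  ∃ K', WeakTrace step K s K'

end Weak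

/-! Notions that depend on the set `T` of continuation names at which a term is running, on the
environment and on the name-support only. -/

inductive Polarity where
  | O : Polarity
  | P : Polarity

/-- All variables are available; a continuation name is available if a term is running at it or
if it occurs in the continuation structure. -/
def Available (T : Set Cont) (γ : Env) : Name → Prop
  | .var _ => True
  | .cont p => p ∈ T ∨ ∃ q, (p, q) ∈ γ.cs ∨ (q, p) ∈ γ.cs

open Classical in
/-- The polarity function for a set `D` of Player names. -/
noncomputable def polarityOf (D : Set Name) (T : Set Cont) (γ : Env) (φ : Finset Name) :
    Name → Option Polarity :=
  fun a => if a ∈ D then some .P else if a ∈ φ ∧ Available T γ a then some .O else none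

open Classical in
/-- The number of answers on `p` that are pending: one from Player if a term is running at `p`,
one from Opponent if `p` is in the domain of the environment, and one from Player for each
continuation of the environment that returns to `p`. -/
noncomputable def pendingOf (T : Set Cont) (γ : Env) (p : Cont) : ℕ :=
  (if p ∈ T then 1 else 0) + (if Name.cont p ∈ γ.dom then 1 else 0) +
    Set.ncard {q : Cont | (q, p) ∈ γ.cs}

/-! Alternating OGS. -/

inductive AConf where
  | active (M : Tm 0) (p : Cont) (γ : Env) (φ : Finset Name) : AConf
  | passive (γ : Env) (φ : Finset Name) : AConf
  | init (M : Tm 0) (φ : Finset Name) : AConf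

inductive AStep : AConf → Option Action → AConf → Prop where
  | tau {M N : Tm 0} {p : Cont} {γ : Env} {φ : Finset Name} :
      Red M N → AStep (.active M p γ φ) none (.active N p γ φ)
  | PA {V : Val} {p : Cont} {γ : Env} {φ : Finset Name} {x : Var} :
      .var x ∉ φ →
      AStep (.active V.1 p γ φ) (some (.ansP p x)) (.passive (γ.setVal x V) (insert (.var x) φ))
  | PQ {E : ECtx} {x : Var} {V : Val} {p : Cont} {γ : Env} {φ : Finset Name} {y : Var}
      {q : Cont} :
      .var y ∉ φ → .cont q ∉ φ →
      AStep (.active (E.plug (.app (.fvar x) V.1)) p γ φ) (some (.questP x y q))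
        (.passive ((γ.setVal y V).setCont q E p) (insert (.var y) (insert (.cont q) φ)))
  | OA {γ : Env} {φ : Finset Name} {q : Cont} {E : ECtx} {p : Cont} {x : Var} :
      γ.cont q = some (E, p) → .var x ∉ φ →
      AStep (.passive γ φ) (some (.ansO q x))
        (.active (E.plug (.fvar x)) p (γ.eraseCont q) (insert (.var x) φ))
  | OQ {γ : Env} {φ : Finset Name} {x : Var} {V : Val} {y : Var} {p : Cont} :
      γ.val x = some V → .var y ∉ φ → .cont p ∉ φ →
      AStep (.passive γ φ) (some (.questO x y p))
        (.active (.app V.1 (.fvar y)) p γ (insert (.var y) (insert (.cont p) φ)))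
  | IOQ {M : Tm 0} {φ : Finset Name} {p : Cont} :
      .cont p ∉ φ →
      AStep (.init M φ) (some (.init p)) (.active M p .empty (insert (.cont p) φ))

namespace AConf

def env : AConf → Env
  | .active _ _ γ _ => γ
  | .passive γ _ => γ
  | .init _ _ => .empty

def supp : AConf → Finset Name
  | .active _ _ _ φ => φ
  | .passive _ φ => φ
  | .init _ φ => φ

/-- The toplevel continuation name, if there is one. -/
def running : AConf → Set Cont
  | .active _ p _ _ => {p}
  | .passive _ _ => ∅
  | .init _ _ => ∅

noncomputable def polarity (F : AConf) : Name → Option Polarity :=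
  polarityOf F.env.dom F.running F.env F.supp

def contStructure (F : AConf) : Set Cont × Set (Cont × Cont) := (F.running, F.env.cs)

noncomputable def pending (F : AConf) : Cont → ℕ := pendingOf F.running F.env

def SupportEquiv (F G : AConf) : Prop :=
  F.polarity = G.polarity ∧ F.contStructure = G.contStructure

def IsOName (F : AConf) (a : Name) : Prop := F.polarity a = some .O

def Valid (F : AConf) : Prop :=
  F.env.dom ⊆ F.supp ∧
  (∀ a ∈ F.env.imageNames, F.IsOName a) ∧
  match F with
  | .active M p _ _ => (∀ x ∈ M.fv, F.IsOName (.var x)) ∧ F.IsOName (.cont p)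
  | .passive _ _ => True
  | .init M φ => (∀ x ∈ M.fv, F.IsOName (.var x)) ∧ ∀ a ∈ φ, ∃ x, a = .var x

/-- `s` is a complete trace for `F` in Alternating OGS. -/
def Complete (F : AConf) (s : Trace) : Prop :=
  HasTrace AStep F s ∧ s.AnswersAll F.pending

/-- Complete-trace equivalence in Alternating OGS. As usual, the bound names of the traces
considered are fresh for both configurations. -/
def CompleteTraceEquiv (F G : AConf) : Prop :=
  F.SupportEquiv G ∧
  ∀ s : Trace, (∀ a ∈ s.bound, a ∉ F.supp ∧ a ∉ G.supp) → (F.Complete s ↔ G.Complete s)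

end AConf

/-! Concurrent OGS. -/

/-- Running terms: partial maps from continuation names to terms. -/
abbrev Running := Cont → Option (Tm 0)

inductive CConf where
  | conf (A : Running) (γ : Env) (φ : Finset Name) : CConf
  | init (M : Tm 0) (φ : Finset Name) : CConf

inductive CStep : CConf → Option Action → CConf → Prop where
  | tau {A : Running} {M N : Tm 0} {p : Cont} {γ : Env} {φ : Finset Name} :
      A p = some M → Red M N →
      CStep (.conf A γ φ) none (.conf (Function.update A p (some N)) γ φ)
  | PA {A : Running} {V : Val} {p : Cont} {γ : Env} {φ : Finset Name} {x : Var} :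
      A p = some V.1 → .var x ∉ φ →
      CStep (.conf A γ φ) (some (.ansP p x))
        (.conf (Function.update A p none) (γ.setVal x V) (insert (.var x) φ))
  | PQ {A : Running} {E : ECtx} {x : Var} {V : Val} {p : Cont} {γ : Env} {φ : Finset Name}
      {y : Var} {q : Cont} :
      A p = some (E.plug (.app (.fvar x) V.1)) → .var y ∉ φ → .cont q ∉ φ →
      CStep (.conf A γ φ) (some (.questP x y q))
        (.conf (Function.update A p none) ((γ.setVal y V).setCont q E p)
          (insert (.var y) (insert (.cont q) φ)))
  | OA {A : Running} {γ : Env} {φ : Finset Name} {p : Cont} {E : ECtx} {q : Cont} {x : Var} :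
      γ.cont p = some (E, q) → A q = none → .var x ∉ φ →
      CStep (.conf A γ φ) (some (.ansO p x))
        (.conf (Function.update A q (some (E.plug (.fvar x)))) (γ.eraseCont p)
          (insert (.var x) φ))
  | OQ {A : Running} {γ : Env} {φ : Finset Name} {x : Var} {V : Val} {y : Var} {p : Cont} :
      γ.val x = some V → .var y ∉ φ → .cont p ∉ φ →
      CStep (.conf A γ φ) (some (.questO x y p))
        (.conf (Function.update A p (some (.app V.1 (.fvar y)))) γ
          (insert (.var y) (insert (.cont p) φ)))
  | IOQ {M : Tm 0} {φ : Finset Name} {p : Cont} :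
      .cont p ∉ φ →
      CStep (.init M φ) (some (.init p))
        (.conf (Function.update (fun _ => none) p (some M)) .empty (insert (.cont p) φ))

namespace CConf

def env : CConf → Env
  | .conf _ γ _ => γ
  | .init _ _ => .empty

def supp : CConf → Finset Name
  | .conf _ _ φ => φ
  | .init _ φ => φ

/-- The domain of the running term. -/
def running : CConf → Set Cont
  | .conf A _ _ => {p | ∃ M, A p = some M}
  | .init _ _ => ∅

/-- In the concurrent setting the names in the domain of the running term count as Player names. -/
noncomputable def polarity (F : CConf) : Name → Option Polarity :=
  polarityOf (F.env.dom ∪ Name.cont '' F.running) F.running F.env F.supp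

def contStructure (F : CConf) : Set Cont × Set (Cont × Cont) := (F.running, F.env.cs)

noncomputable def pending (F : CConf) : Cont → ℕ := pendingOf F.running F.env

def SupportEquiv (F G : CConf) : Prop :=
  F.polarity = G.polarity ∧ F.contStructure = G.contStructure

/-- `s` is a complete trace for `F` in Concurrent OGS. -/
def Complete (F : CConf) (s : Trace) : Prop :=
  HasTrace CStep F s ∧ s.AnswersAll F.pending

/-- Complete-trace equivalence in Concurrent OGS. -/
def CompleteTraceEquiv (F G : CConf) : Prop :=
  F.SupportEquiv G ∧
  ∀ s : Trace, (∀ a ∈ s.bound, a ∉ F.supp ∧ a ∉ G.supp) → (F.Complete s ↔ G.Complete s)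

end CConf

/-- Alternating configurations as concurrent ones with an empty or singleton running term. -/
def AConf.toC : AConf → CConf
  | .active M p γ φ => .conf (Function.update (fun _ => none) p (some M)) γ φ
  | .passive γ φ => .conf (fun _ => none) γ φ
  | .init M φ => .init M φ

/-! Well-Bracketed OGS. -/

abbrev Stack := List Cont

inductive WBConf where
  | active (M : Tm 0) (p : Cont) (σ : Stack) (γ : Env) (φ : Finset Name) : WBConf
  | passive (σ : Stack) (γ : Env) (φ : Finset Name) : WBConf
  | init (M : Tm 0) (φ : Finset Name) : WBConf

inductive WBStep : WBConf → Option Action → WBConf → Prop where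
  | tau {M N : Tm 0} {p : Cont} {σ : Stack} {γ : Env} {φ : Finset Name} :
      Red M N → WBStep (.active M p σ γ φ) none (.active N p σ γ φ)
  | PA {V : Val} {p : Cont} {σ : Stack} {γ : Env} {φ : Finset Name} {x : Var} :
      .var x ∉ φ →
      WBStep (.active V.1 p σ γ φ) (some (.ansP p x))
        (.passive σ (γ.setVal x V) (insert (.var x) φ))
  | PQ {E : ECtx} {x : Var} {V : Val} {p : Cont} {σ : Stack} {γ : Env} {φ : Finset Name}
      {y : Var} {q : Cont} :
      .var y ∉ φ → .cont q ∉ φ →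
      WBStep (.active (E.plug (.app (.fvar x) V.1)) p σ γ φ) (some (.questP x y q))
        (.passive (q :: σ) ((γ.setVal y V).setCont q E p)
          (insert (.var y) (insert (.cont q) φ)))
  | OA {σ : Stack} {γ : Env} {φ : Finset Name} {p : Cont} {E : ECtx} {q : Cont} {x : Var} :
      γ.cont p = some (E, q) → .var x ∉ φ →
      WBStep (.passive (p :: σ) γ φ) (some (.ansO p x))
        (.active (E.plug (.fvar x)) q σ (γ.eraseCont p) (insert (.var x) φ))
  | OQ {σ : Stack} {γ : Env} {φ : Finset Name} {x : Var} {V : Val} {y : Var} {p : Cont} :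
      γ.val x = some V → .var y ∉ φ → .cont p ∉ φ →
      WBStep (.passive σ γ φ) (some (.questO x y p))
        (.active (.app V.1 (.fvar y)) p σ γ (insert (.var y) (insert (.cont p) φ)))
  | IOQ {M : Tm 0} {φ : Finset Name} {p : Cont} :
      .cont p ∉ φ →
      WBStep (.init M φ) (some (.init p)) (.active M p [] .empty (insert (.cont p) φ))

/-- The pushdown system of well-bracketing: Player questions push the continuation name that they
introduce, Opponent answers pop their subject. -/
inductive PushdownStep : Stack → Action → Stack → Prop where
  | PQ {σ : Stack} {x y : Var} {p : Cont} : p ∉ σ → PushdownStep σ (.questP x y p) (p :: σ)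
  | OQ {σ : Stack} {x y : Var} {p : Cont} : PushdownStep σ (.questO x y p) σ
  | IOQ {σ : Stack} {p : Cont} : PushdownStep σ (.init p) σ
  | PA {σ : Stack} {p : Cont} {x : Var} : PushdownStep σ (.ansP p x) σ
  | OA {σ : Stack} {p : Cont} {x : Var} : PushdownStep (p :: σ) (.ansO p x) σ

def PushdownTrace : Stack → Trace → Stack → Prop
  | σ, [], σ' => σ = σ'
  | σ, l :: s, σ' => ∃ σ₁, PushdownStep σ l σ₁ ∧ PushdownTrace σ₁ s σ'

namespace WBConf

def stack : WBConf → Stack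
  | .active _ _ σ _ _ => σ
  | .passive σ _ _ => σ
  | .init _ _ => []

/-- Removal of the stack. -/
def erase : WBConf → AConf
  | .active M p _ γ φ => .active M p γ φ
  | .passive _ γ φ => .passive γ φ
  | .init M φ => .init M φ

/-- The stack lists the Player continuation names, each exactly once. -/
def Valid (F : WBConf) : Prop :=
  F.erase.Valid ∧ F.stack.Nodup ∧ ∀ p : Cont, p ∈ F.stack ↔ Name.cont p ∈ F.erase.env.dom

def SupportEquiv (F G : WBConf) : Prop :=
  F.erase.SupportEquiv G.erase ∧ F.stack = G.stack

/-- `s` is a complete trace for `F` in Well-Bracketed OGS. -/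
def Complete (F : WBConf) (s : Trace) : Prop :=
  HasTrace WBStep F s ∧ PushdownTrace F.stack s [] ∧ s.AnswersAll F.erase.pending

/-- Complete-trace equivalence in Well-Bracketed OGS. -/
def CompleteTraceEquiv (F G : WBConf) : Prop :=
  F.SupportEquiv G ∧
  ∀ s : Trace, (∀ a ∈ s.bound, a ∉ F.erase.supp ∧ a ∉ G.erase.supp) →
    (F.Complete s ↔ G.Complete s)

end WBConf

end OGS

namespace OGS

/-! Determinism of reduction. -/

/-! The equivalences are proved in the cycle WB ⇒ Concurrent ⇒ Alternating ⇒ WB. The last two are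
restrictions: complete Alternating traces are the alternating complete Concurrent ones
(`AConf.complete_iff`), and complete WB traces are the Alternating ones that respect the stack
(`WBConf.complete_iff`). The content is in WB ⇒ Concurrent.

Answer counting shows that a concurrent trace is complete iff its run ends with no running thread
and no stored continuation (`CConf.complete_iff`). Such a run can be reordered. When a thread is
running, its next event is a Player action, which commutes with all earlier events. When none is
running and `q` is on top of the stack, `q` must be answered at some point, and that answer,
together with the Player action that ends the thread it resumes, commutes to the front. When there
is no thread and no stored continuation, the first event is already a legal well-bracketed move. So
a first well-bracketed block can always be split off (`WBState.exists_block`), and iterating this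
serializes the whole run (`WBState.exists_serial`).

To transfer a complete concurrent run `s` from `F` to `G`, split off a block `β` with remainder
`rest`. Serializing `rest` makes `β` the beginning of a complete well-bracketed trace of `F`, hence
of `G`. By determinism, `G` reaches after `β` a unique state, and inclusion of well-bracketed traces
still holds between the two successors (`WBIncl.run`). Induction on length gives the run of `rest`
in `G`, and the commutations, read backwards in `G`, restore `s` (`WBIncl.run_of_run`). -/

theorem ECtx.plug_app_not_isValue (E : ECtx) (M N : Tm 0) : ¬ (E.plug (.app M N)).IsValue := by
  cases E <;> simp [ECtx.plug, Tm.IsValue]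

theorem ECtx.val_ne_plug_app (V : Val) (E : ECtx) (M N : Tm 0) : V.1 ≠ E.plug (.app M N) :=
  fun h => E.plug_app_not_isValue M N (h ▸ V.2)

/-- Unique decomposition, as no value is a context filled with an application. The function part may
be a variable or an abstraction, so redexes and stuck terms are both covered. -/
theorem ECtx.plug_app_inj {V W V' W' : Val} {E E' : ECtx}
    (h : E.plug (.app V.1 W.1) = E'.plug (.app V'.1 W'.1)) : E = E' ∧ V = V' ∧ W = W' := by
  induction E generalizing E' with
  | hole =>
    cases E' with
    | hole =>
      simp only [ECtx.plug, Tm.app.injEq] at h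
      exact ⟨rfl, Subtype.ext h.1, Subtype.ext h.2⟩
    | appR U E' =>
      simp only [ECtx.plug, Tm.app.injEq] at h
      exact absurd h.2 (ECtx.val_ne_plug_app _ _ _ _)
    | appL E' N =>
      simp only [ECtx.plug, Tm.app.injEq] at h
      exact absurd h.1 (ECtx.val_ne_plug_app _ _ _ _)
  | appR U E ih =>
    cases E' with
    | hole =>
      simp only [ECtx.plug, Tm.app.injEq] at h
      exact absurd h.2.symm (ECtx.val_ne_plug_app _ _ _ _)
    | appR U' E' =>
      simp only [ECtx.plug, Tm.app.injEq] at h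
      obtain ⟨rfl, h2⟩ := ih h.2
      exact ⟨by rw [Subtype.ext h.1], h2⟩
    | appL E' N =>
      simp only [ECtx.plug, Tm.app.injEq] at h
      exact absurd h.1 (ECtx.val_ne_plug_app _ _ _ _)
  | appL E N ih =>
    cases E' with
    | hole =>
      simp only [ECtx.plug, Tm.app.injEq] at h
      exact absurd h.1.symm (ECtx.val_ne_plug_app _ _ _ _)
    | appR U' E' =>
      simp only [ECtx.plug, Tm.app.injEq] at h
      exact absurd h.1.symm (ECtx.val_ne_plug_app _ _ _ _)
    | appL E' N' =>
      simp only [ECtx.plug, Tm.app.injEq] at h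
      obtain ⟨rfl, h2⟩ := ih h.1
      exact ⟨by rw [h.2], h2⟩

def ECtx.comp : ECtx → ECtx → ECtx
  | .hole, E' => E'
  | .appR V E, E' => .appR V (E.comp E')
  | .appL E N, E' => .appL (E.comp E') N

theorem ECtx.plug_comp (E E' : ECtx) (M : Tm 0) : (E.comp E').plug M = E.plug (E'.plug M) := by
  induction E <;> simp_all [ECtx.comp, ECtx.plug]

def Val.lam (M : Tm 1) : Val := ⟨.lam M, trivial⟩

def Val.fvar (x : Var) : Val := ⟨.fvar x, trivial⟩

theorem Red.exists_plug {M N : Tm 0} (h : Red M N) :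
    ∃ (E : ECtx) (B : Tm 1) (V : Val),
      M = E.plug (.app (Val.lam B).1 V.1) ∧ N = E.plug (B.inst V.1) := by
  induction h with
  | beta M V => exact ⟨.hole, M, V, rfl, rfl⟩
  | ctx E _ ih =>
    obtain ⟨E', B, V, rfl, rfl⟩ := ih
    exact ⟨E.comp E', B, V, (E.plug_comp _ _).symm, (E.plug_comp _ _).symm⟩

theorem Red.rightUnique : Relator.RightUnique Red := by
  intro M N N' h h'
  obtain ⟨E, B, V, rfl, rfl⟩ := h.exists_plug
  obtain ⟨E', B', V', he, rfl⟩ := h'.exists_plug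
  obtain ⟨rfl, hl, rfl⟩ := ECtx.plug_app_inj he
  have hB : Tm.lam B = Tm.lam B' := congrArg Subtype.val hl
  cases hB
  rfl

theorem Red.not_val (V : Val) (N : Tm 0) : ¬ Red V.1 N := by
  intro h
  obtain ⟨E, B, W, he, -⟩ := h.exists_plug
  exact ECtx.val_ne_plug_app _ _ _ _ he

theorem Red.not_stuck (E : ECtx) (x : Var) (V : Val) (N : Tm 0) :
    ¬ Red (E.plug (.app (.fvar x) V.1)) N := by
  intro h
  obtain ⟨E', B, W, he, -⟩ := h.exists_plug
  obtain ⟨-, h2, -⟩ := ECtx.plug_app_inj (V := Val.fvar x) he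
  have : Tm.fvar x = Tm.lam B := congrArg Subtype.val h2
  cases this

abbrev RedStar : Tm 0 → Tm 0 → Prop := Relation.ReflTransGen Red

/-- Reduction is deterministic, so two reduction sequences from one term are comparable, and the
shorter cannot be extended. -/
theorem RedStar.normal_unique {M N N' : Tm 0} (h : RedStar M N) (h' : RedStar M N')
    (hN : ∀ L, ¬ Red N L) (hN' : ∀ L, ¬ Red N' L) : N = N' := by
  rcases Relation.ReflTransGen.total_of_right_unique Red.rightUnique h h' with h | h
  · rcases h.cases_head with h | ⟨L, hL, -⟩
    · exact h
    · exact absurd hL (hN L)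
  · rcases h.cases_head with h | ⟨L, hL, -⟩
    · exact h.symm
    · exact absurd hL (hN' L)

/-! A big-step presentation of Concurrent OGS. Silent steps are performed by the Player actions,
freshness of bound names is a property of traces, and each action carries the continuation name of
the thread that it starts, resumes or stops. -/

/-- `start` holds the term of an initial configuration until the initial question consumes it. -/
structure St where
  start : Option (Tm 0)
  thr : Running
  val : Var → Option Val
  cont : Cont → Option (ECtx × Cont)

theorem St.ext' {K L : St} (h0 : K.start = L.start) (h1 : ∀ p, K.thr p = L.thr p)
    (h2 : ∀ x, K.val x = L.val x) (h3 : ∀ q, K.cont q = L.cont q) : K = L := by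
  cases K; cases L
  simp only [St.mk.injEq]
  exact ⟨h0, funext h1, funext h2, funext h3⟩

abbrev Event := Action × Cont

-- The conditions `K.cont q = none` in `PQ` and `K.thr p = none` in `OQ` and `IOQ` are all that
-- these rules keep of freshness.
open Function in
inductive BStep : St → Event → St → Prop where
  | PA {K : St} {p : Cont} {M : Tm 0} {V : Val} {x : Var} :
      K.thr p = some M → RedStar M V.1 →
      BStep K (.ansP p x, p)
        ⟨K.start, update K.thr p none, update K.val x (some V), K.cont⟩
  | PQ {K : St} {p : Cont} {M : Tm 0} {E : ECtx} {x : Var} {V : Val} {y : Var} {q : Cont} :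
      K.thr p = some M → RedStar M (E.plug (.app (.fvar x) V.1)) → K.cont q = none →
      BStep K (.questP x y q, p)
        ⟨K.start, update K.thr p none, update K.val y (some V), update K.cont q (some (E, p))⟩
  | OA {K : St} {q p : Cont} {E : ECtx} {x : Var} :
      K.cont q = some (E, p) → K.thr p = none →
      BStep K (.ansO q x, p)
        ⟨K.start, update K.thr p (some (E.plug (.fvar x))), K.val, update K.cont q none⟩
  | OQ {K : St} {x : Var} {V : Val} {y : Var} {p : Cont} :
      K.val x = some V → K.thr p = none →
      BStep K (.questO x y p, p)
        ⟨K.start, update K.thr p (some (.app V.1 (.fvar y))), K.val, K.cont⟩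
  | IOQ {K : St} {M : Tm 0} {p : Cont} :
      K.start = some M → K.thr p = none →
      BStep K (.init p, p) ⟨none, update K.thr p (some M), K.val, K.cont⟩

def Run : St → List Event → St → Prop
  | K, [], K' => K = K'
  | K, e :: s, K' => ∃ K₁, BStep K e K₁ ∧ Run K₁ s K'

theorem run_append {K K' : St} {s t : List Event} :
    Run K (s ++ t) K' ↔ ∃ K₁, Run K s K₁ ∧ Run K₁ t K' := by
  induction s generalizing K with
  | nil => simp [Run]
  | cons e s ih =>
    simp only [List.cons_append, Run, ih]
    constructor
    · rintro ⟨K₁, h, K₂, h1, h2⟩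
      exact ⟨K₂, ⟨K₁, h, h1⟩, h2⟩
    · rintro ⟨K₂, ⟨K₁, h, h1⟩, h2⟩
      exact ⟨K₁, h, K₂, h1, h2⟩

/-- No thread is running and no continuation is stored. -/
def Terminal (K : St) : Prop := (∀ p, K.thr p = none) ∧ ∀ q, K.cont q = none

def Action.IsPlayer : Action → Bool
  | .ansP _ _ => true
  | .questP _ _ _ => true
  | _ => false

/-- A Player event leads to the unique normal form of the thread, whose decomposition is unique, and
the bound names are part of the label. -/
theorem BStep.unique {K K₁ K₂ : St} {e : Event} (h₁ : BStep K e K₁) (h₂ : BStep K e K₂) :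
    K₁ = K₂ := by
  cases h₁ with
  | PA h r =>
    cases h₂ with
    | PA h' r' =>
      rw [h] at h'; cases h'
      rw [Subtype.ext (r.normal_unique r' (Red.not_val _) (Red.not_val _))]
  | PQ h r =>
    cases h₂ with
    | PQ h' r' =>
      rw [h] at h'; cases h'
      obtain ⟨rfl, -, rfl⟩ := ECtx.plug_app_inj (V := Val.fvar _) (V' := Val.fvar _)
        (r.normal_unique r' (Red.not_stuck _ _ _) (Red.not_stuck _ _ _))
      rfl
  | OA h r =>
    cases h₂ with
    | OA h' r' => rw [h] at h'; cases h'; rfl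
  | OQ h r =>
    cases h₂ with
    | OQ h' r' => rw [h] at h'; cases h'; rfl
  | IOQ h r =>
    cases h₂ with
    | IOQ h' r' => rw [h] at h'; cases h'; rfl

/-! States with the same continuation structure. -/

def SameShape (K L : St) : Prop :=
  (∀ p, K.thr p = none ↔ L.thr p = none) ∧
    ∀ q, (K.cont q).map Prod.snd = (L.cont q).map Prod.snd

theorem SameShape.cont_eq {K L : St} (h : SameShape K L) {q p : Cont} {E : ECtx}
    (hq : K.cont q = some (E, p)) : ∃ E', L.cont q = some (E', p) := by
  have := h.2 q
  rw [hq] at this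
  cases hL : L.cont q with
  | none => simp [hL] at this
  | some r =>
    simp only [hL, Option.map_some, Option.some.injEq] at this
    exact ⟨r.1, by rw [this]⟩

/-- The event records its thread, so the change of shape can be read off the event alone. -/
theorem SameShape.step {K L K' L' : St} {e : Event} (h : SameShape K L) (hK : BStep K e K')
    (hL : BStep L e L') : SameShape K' L' := by
  obtain ⟨h1, h2⟩ := h
  cases hK <;> cases hL <;> refine ⟨fun r => ?_, fun r => ?_⟩ <;>
    simp only [Function.update_apply] <;> (try split_ifs) <;>
    first
    | exact h1 r
    | exact h2 r
    | simp

theorem SameShape.run {K L K' L' : St} {s : List Event} (h : SameShape K L) (hK : Run K s K')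
    (hL : Run L s L') : SameShape K' L' := by
  induction s generalizing K L with
  | nil => cases hK; cases hL; exact h
  | cons e s ih =>
    obtain ⟨K₁, a, b⟩ := hK
    obtain ⟨L₁, c, d⟩ := hL
    exact ih (h.step a c) b d

/-! Replacing the resources in `X`, `Y`, `Z` of a state by those of another state. -/

section Patch

variable (X Y : Set Cont) (Z : Set Var)

open Classical in
noncomputable def patch (K B : St) : St :=
  ⟨K.start, fun p => if p ∈ X then B.thr p else K.thr p,
    fun x => if x ∈ Z then B.val x else K.val x,
    fun q => if q ∈ Y then B.cont q else K.cont q⟩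

def AgreeOn (K L : St) : Prop :=
  (∀ p ∈ X, K.thr p = L.thr p) ∧ (∀ q ∈ Y, K.cont q = L.cont q) ∧ ∀ x ∈ Z, K.val x = L.val x

/-- The event does not use the resources in `X`, `Y`, `Z`. -/
def Avoids (e : Event) : Prop :=
  e.2 ∉ X ∧
  match e.1 with
  | .ansP _ x => x ∉ Z
  | .ansO q _ => q ∉ Y
  | .questP _ y q => y ∉ Z ∧ q ∉ Y
  | .questO x _ _ => x ∉ Z
  | .init _ => True

variable {X Y Z}

theorem AgreeOn.symm {K L : St} (h : AgreeOn X Y Z K L) : AgreeOn X Y Z L K :=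
  ⟨fun p hp => (h.1 p hp).symm, fun p hp => (h.2.1 p hp).symm, fun p hp => (h.2.2 p hp).symm⟩

theorem AgreeOn.trans {K L M : St} (h : AgreeOn X Y Z K L) (h' : AgreeOn X Y Z L M) :
    AgreeOn X Y Z K M :=
  ⟨fun p hp => (h.1 p hp).trans (h'.1 p hp), fun p hp => (h.2.1 p hp).trans (h'.2.1 p hp),
    fun p hp => (h.2.2 p hp).trans (h'.2.2 p hp)⟩

theorem agreeOn_patch (K B : St) : AgreeOn X Y Z (patch X Y Z K B) B :=
  ⟨fun p hp => by simp [patch, hp], fun p hp => by simp [patch, hp],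
    fun p hp => by simp [patch, hp]⟩

theorem AgreeOn.patch_eq {K B : St} (h : AgreeOn X Y Z K B) : patch X Y Z K B = K := by
  apply St.ext'
  · rfl
  all_goals
    intro r
    simp only [patch]
    split_ifs with hr
    · first
      | exact (h.1 r hr).symm
      | exact (h.2.1 r hr).symm
      | exact (h.2.2 r hr).symm
    · rfl

theorem patch_patch (K B C : St) : patch X Y Z (patch X Y Z K B) C = patch X Y Z K C := by
  apply St.ext'
  · rfl
  all_goals
    intro r
    simp only [patch]
    split_ifs <;> rfl

theorem patch_self (K : St) : patch X Y Z K K = K := by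
  apply St.ext' <;> simp [patch]

theorem BStep.agreeOn {K K' : St} {e : Event} (he : Avoids X Y Z e) (h : BStep K e K') :
    AgreeOn X Y Z K' K := by
  cases h <;> simp only [Avoids] at he <;> refine ⟨fun r hr => ?_, fun r hr => ?_, fun r hr => ?_⟩ <;>
    simp only [Function.update_apply] <;> (try split_ifs with hq) <;>
    (try rfl) <;> subst hq <;> exfalso <;> tauto

/-- Frame property: a rule neither reads nor writes the resources that its event avoids, so their
contents may be replaced. -/
theorem BStep.patch {K K' : St} {e : Event} (B : St) (he : Avoids X Y Z e) (h : BStep K e K') :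
    BStep (patch X Y Z K B) e (patch X Y Z K' B) := by
  classical
  cases h with
  | @PA p M V x h r =>
    have hp : p ∉ X := he.1
    have hx : x ∉ Z := he.2
    convert BStep.PA (K := OGS.patch X Y Z K B) (p := p) (x := x) (by simpa [OGS.patch, hp] using h) r
      using 1
    apply St.ext' <;> simp only [OGS.patch, Function.update_apply] <;> grind
  | @PQ p M E x V y q h r hq =>
    have hp : p ∉ X := he.1
    have hx : y ∉ Z := he.2.1
    have hY : q ∉ Y := he.2.2
    convert BStep.PQ (K := OGS.patch X Y Z K B) (p := p) (y := y) (q := q)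
      (by simpa [OGS.patch, hp] using h) r (by simpa [OGS.patch, hY] using hq) using 1
    apply St.ext' <;> simp only [OGS.patch, Function.update_apply] <;> grind
  | @OA q p E x h r =>
    have hp : p ∉ X := he.1
    have hY : q ∉ Y := he.2
    convert BStep.OA (K := OGS.patch X Y Z K B) (p := p) (x := x) (q := q)
      (by simpa [OGS.patch, hY] using h) (by simpa [OGS.patch, hp] using r) using 1
    apply St.ext' <;> simp only [OGS.patch, Function.update_apply] <;> grind
  | @OQ x V y p h r =>
    have hp : p ∉ X := he.1
    have hx : x ∉ Z := he.2
    convert BStep.OQ (K := OGS.patch X Y Z K B) (p := p) (x := x) (y := y)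
      (by simpa [OGS.patch, hx] using h) (by simpa [OGS.patch, hp] using r) using 1
    apply St.ext' <;> simp only [OGS.patch, Function.update_apply] <;> grind
  | @IOQ M p h r =>
    have hp : p ∉ X := he.1
    convert BStep.IOQ (K := OGS.patch X Y Z K B) (p := p) h
      (by simpa [OGS.patch, hp] using r) using 1
    apply St.ext' <;> simp only [OGS.patch, Function.update_apply] <;> grind

theorem Run.agreeOn {K K' : St} {s : List Event} (hs : ∀ e ∈ s, Avoids X Y Z e)
    (h : Run K s K') : AgreeOn X Y Z K' K := by
  induction s generalizing K with
  | nil => cases h; exact ⟨fun _ _ => rfl, fun _ _ => rfl, fun _ _ => rfl⟩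
  | cons e s ih =>
    obtain ⟨K₁, a, b⟩ := h
    exact (ih (fun e he => hs e (by simp [he])) b).trans (a.agreeOn (hs e (by simp)))

theorem Run.patch {K K' : St} {s : List Event} (B : St) (hs : ∀ e ∈ s, Avoids X Y Z e)
    (h : Run K s K') : Run (patch X Y Z K B) s (patch X Y Z K' B) := by
  induction s generalizing K with
  | nil => cases h; rfl
  | cons e s ih =>
    obtain ⟨K₁, a, b⟩ := h
    exact ⟨_, a.patch B (hs e (by simp)), ih (fun e he => hs e (by simp [he])) b⟩

end Patch

/-! Moving a Player action, or an Opponent answer with the Player action that follows it. -/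

def Action.contBound (a : Action) : Set Cont := {q | .cont q ∈ a.bound}

def Action.varBound (a : Action) : Set Var := {x | .var x ∈ a.bound}

/-- A Player action is a local overwrite: what it writes is determined by the thread `p` and is
stored at the names it binds. Any state agreeing on these resources can therefore perform the same
overwrite. -/
theorem BStep.player_effect {K K' : St} {a : Action} {p : Cont} (ha : a.IsPlayer = true)
    (h : BStep K (a, p) K') :
    ∃ B, K' = OGS.patch {p} a.contBound a.varBound K B ∧
      ∀ L, AgreeOn {p} a.contBound a.varBound L K →
        BStep L (a, p) (OGS.patch {p} a.contBound a.varBound L B) := by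
  cases h with
  | @PA _ M V x h r =>
    have key : ∀ L : St, (⟨L.start, Function.update L.thr p none, Function.update L.val x (some V),
        L.cont⟩ : St) = OGS.patch {p} (Action.ansP p x).contBound (Action.ansP p x).varBound L
          ⟨none, fun _ => none, fun _ => some V, fun _ => none⟩ := by
      intro L
      apply St.ext' <;>
        simp [OGS.patch, Function.update_apply, Action.contBound, Action.varBound, Action.bound]
    refine ⟨⟨none, fun _ => none, fun _ => some V, fun _ => none⟩, key K, fun L hL => ?_⟩
    rw [← key]
    exact BStep.PA ((hL.1 p rfl).trans h) r
  | @PQ _ M E x V y q h r hq =>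
    have key : ∀ L : St, (⟨L.start, Function.update L.thr p none, Function.update L.val y (some V),
        Function.update L.cont q (some (E, p))⟩ : St) =
        OGS.patch {p} (Action.questP x y q).contBound (Action.questP x y q).varBound L
          ⟨none, fun _ => none, fun _ => some V, fun _ => some (E, p)⟩ := by
      intro L
      apply St.ext' <;>
        simp [OGS.patch, Function.update_apply, Action.contBound, Action.varBound, Action.bound]
    refine ⟨⟨none, fun _ => none, fun _ => some V, fun _ => some (E, p)⟩, key K, fun L hL => ?_⟩
    rw [← key]
    refine BStep.PQ ((hL.1 p rfl).trans h) r ((hL.2.1 q ?_).trans hq)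
    simp [Action.contBound, Action.bound]
  | OA => simp [Action.IsPlayer] at ha
  | OQ => simp [Action.IsPlayer] at ha
  | IOQ => simp [Action.IsPlayer] at ha

theorem player_move_front {K K₁ K₂ : St} {a : Action} {p : Cont} {u : List Event}
    (ha : a.IsPlayer = true) (hu : ∀ e ∈ u, Avoids {p} a.contBound a.varBound e)
    (h : Run K u K₁) (hs : BStep K₁ (a, p) K₂) : ∃ L, BStep K (a, p) L ∧ Run L u K₂ := by
  obtain ⟨B, rfl, hB⟩ := hs.player_effect ha
  exact ⟨_, hB K (h.agreeOn hu).symm, h.patch B hu⟩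

theorem player_move_back {K K₁ K₂ : St} {a : Action} {p : Cont} {u : List Event}
    (ha : a.IsPlayer = true) (hu : ∀ e ∈ u, Avoids {p} a.contBound a.varBound e)
    (hs : BStep K (a, p) K₁) (h : Run K₁ u K₂) : ∃ L, Run K u L ∧ BStep L (a, p) K₂ := by
  obtain ⟨B, rfl, hB⟩ := hs.player_effect ha
  -- Restoring the contents that `K` has at the resources of the action undoes the action along the
  -- whole run.
  have h1 := h.patch K hu
  rw [patch_patch, patch_self] at h1
  refine ⟨_, h1, ?_⟩
  have h2 := hB _ (agreeOn_patch K₂ K)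
  rwa [patch_patch, ((h.agreeOn hu).trans (agreeOn_patch K B)).patch_eq] at h2

/-- The thread `p` is idle before and after the pair, so the net effect touches no thread, whence
the `∅`. Events that use `p` can thus be crossed by the pair, though not by the answer alone. -/
theorem answer_effect {K K₁ K₂ : St} {a : Action} {p q : Cont} {x : Var} (ha : a.IsPlayer = true)
    (hq : q ∉ a.contBound) (h₁ : BStep K (.ansO q x, p) K₁) (h₂ : BStep K₁ (a, p) K₂) :
    ∃ B, K₂ = patch ∅ (insert q a.contBound) a.varBound K B ∧
      ∀ L, L.thr p = none → AgreeOn ∅ (insert q a.contBound) a.varBound L K →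
        Run L [(.ansO q x, p), (a, p)] (patch ∅ (insert q a.contBound) a.varBound L B) := by
  cases h₁ with
  | @OA _ _ E _ hc ht =>
  cases h₂ with
  | @PA _ M V y h r =>
    have key : ∀ L : St, L.thr p = none → (⟨L.start, Function.update (Function.update L.thr p
        (some (E.plug (.fvar x)))) p none, Function.update L.val y (some V),
        Function.update L.cont q none⟩ : St) =
        OGS.patch ∅ (insert q (Action.ansP p y).contBound) (Action.ansP p y).varBound L
          ⟨none, fun _ => none, fun _ => some V, fun _ => none⟩ := by
      intro L hL
      apply St.ext' <;> simp [OGS.patch, Function.update_apply, Action.contBound,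
        Action.varBound, Action.bound]
      grind
    refine ⟨_, key K ht, fun L ht' hL => ?_⟩
    rw [← key L ht']
    refine ⟨_, BStep.OA ((hL.2.1 q (by simp)).trans hc) ht', _, BStep.PA ?_ r, rfl⟩
    simpa using h
  | @PQ _ M E' z V y q' h r hn =>
    have hqq : q ≠ q' := by
      rintro rfl
      exact hq (by simp [Action.contBound, Action.bound])
    have key : ∀ L : St, L.thr p = none → (⟨L.start, Function.update (Function.update L.thr p
        (some (E.plug (.fvar x)))) p none, Function.update L.val y (some V),
        Function.update (Function.update L.cont q none) q' (some (E', p))⟩ : St) =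
        OGS.patch ∅ (insert q (Action.questP z y q').contBound) (Action.questP z y q').varBound L
          ⟨none, fun _ => none, fun _ => some V,
            fun r => if r = q then none else some (E', p)⟩ := by
      intro L hL
      apply St.ext' <;> simp [OGS.patch, Function.update_apply, Action.contBound,
        Action.varBound, Action.bound]
      all_goals grind
    refine ⟨_, key K ht, fun L ht' hL => ?_⟩
    rw [← key L ht']
    refine ⟨_, BStep.OA ((hL.2.1 q (by simp)).trans hc) ht', _, BStep.PQ ?_ r ?_, rfl⟩
    · simpa using h
    · have := hL.2.1 q' (by simp [Action.contBound, Action.bound])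
      simp only [Function.update_apply, if_neg hqq.symm] at hn ⊢
      exact this.trans hn
  | OA => simp [Action.IsPlayer] at ha
  | OQ => simp [Action.IsPlayer] at ha
  | IOQ => simp [Action.IsPlayer] at ha

theorem answer_move_front {K K₁ K₂ K₃ : St} {a : Action} {p q : Cont} {x : Var} {u : List Event}
    (ha : a.IsPlayer = true) (hq : q ∉ a.contBound)
    (hu : ∀ e ∈ u, Avoids ∅ (insert q a.contBound) a.varBound e) (hp : K.thr p = none)
    (h : Run K u K₁) (h₁ : BStep K₁ (.ansO q x, p) K₂) (h₂ : BStep K₂ (a, p) K₃) :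
    ∃ L, Run K [(.ansO q x, p), (a, p)] L ∧ Run L u K₃ := by
  obtain ⟨B, rfl, hB⟩ := answer_effect ha hq h₁ h₂
  exact ⟨_, hB K hp (h.agreeOn hu).symm, h.patch B hu⟩

/-- `u` may contain events at `p`, so the idleness of `p` after `u` is left as a condition to be
supplied by the caller. -/
theorem answer_move_back {K K₁ K₂ : St} {a : Action} {p q : Cont} {x : Var} {u : List Event}
    (ha : a.IsPlayer = true) (hq : q ∉ a.contBound)
    (hu : ∀ e ∈ u, Avoids ∅ (insert q a.contBound) a.varBound e)
    (hs : Run K [(.ansO q x, p), (a, p)] K₁) (h : Run K₁ u K₂) :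
    ∃ L, Run K u L ∧ (L.thr p = none → Run L [(.ansO q x, p), (a, p)] K₂) := by
  obtain ⟨_, h₁, _, h₂, rfl⟩ := hs
  obtain ⟨B, rfl, hB⟩ := answer_effect ha hq h₁ h₂
  have h3 := h.patch K hu
  rw [patch_patch, patch_self] at h3
  refine ⟨_, h3, fun hp => ?_⟩
  have h4 := hB _ hp (agreeOn_patch K₂ K)
  rwa [patch_patch, ((h.agreeOn hu).trans (agreeOn_patch K B)).patch_eq] at h4

/-! Freshness, name-supports and well-bracketed runs. -/

/-- The trace underlying a list of events. -/
def actions (s : List Event) : Trace := s.map Prod.fst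

/-- The bound names of `s` are pairwise distinct and outside `φ`. -/
def Fresh (φ : Set Name) (s : Trace) : Prop := s.bound.Nodup ∧ ∀ a ∈ s.bound, a ∉ φ

/-- The names that `K` uses are in `φ`. -/
structure Supported (φ : Set Name) (K : St) : Prop where
  thr : ∀ p, K.thr p ≠ none → Name.cont p ∈ φ
  val : ∀ x, K.val x ≠ none → Name.var x ∈ φ
  cont : ∀ q E p, K.cont q = some (E, p) → Name.cont q ∈ φ ∧ Name.cont p ∈ φ

theorem actions_cons (e : Event) (s : List Event) : actions (e :: s) = e.1 :: actions s := rfl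

theorem actions_append (s t : List Event) : actions (s ++ t) = actions s ++ actions t :=
  List.map_append

theorem bound_cons (a : Action) (s : Trace) :
    Trace.bound (a :: s) = a.bound ++ Trace.bound s := rfl

theorem bound_append (s t : Trace) : Trace.bound (s ++ t) = s.bound ++ t.bound :=
  List.flatMap_append

theorem fresh_append {φ : Set Name} {s t : Trace} :
    Fresh φ (s ++ t) ↔ Fresh φ s ∧ Fresh (φ ∪ {a | a ∈ s.bound}) t := by
  simp only [Fresh, bound_append, List.nodup_append, List.mem_append, Set.mem_union,
    Set.mem_ofPred_eq]
  constructor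
  · rintro ⟨⟨h1, h2, h3⟩, h4⟩
    exact ⟨⟨h1, fun a ha => h4 a (.inl ha)⟩, h2, fun a ha =>
      not_or.2 ⟨h4 a (.inr ha), fun h => h3 a h a ha rfl⟩⟩
  · rintro ⟨⟨h1, h2⟩, h3, h4⟩
    refine ⟨⟨h1, h3, ?_⟩, ?_⟩
    · rintro a ha b hb rfl
      exact h4 a hb (.inr ha)
    · rintro a (ha | ha)
      · exact h2 a ha
      · exact fun h => h4 a ha (.inl h)

theorem fresh_cons {φ : Set Name} {a : Action} {s : Trace} :
    Fresh φ (a :: s) ↔ Fresh φ [a] ∧ Fresh (φ ∪ {b | b ∈ a.bound}) s := by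
  have := fresh_append (φ := φ) (s := [a]) (t := s)
  simpa [Trace.bound] using this

theorem Fresh.perm {φ : Set Name} {s t : Trace} (h : s.Perm t) (hs : Fresh φ s) : Fresh φ t := by
  have hp : s.bound.Perm t.bound := h.flatMap_right _
  exact ⟨hp.nodup_iff.1 hs.1, fun a ha => hs.2 a (hp.mem_iff.2 ha)⟩

theorem Fresh.mono {φ ψ : Set Name} {s : Trace} (h : φ ⊆ ψ) (hs : Fresh ψ s) : Fresh φ s :=
  ⟨hs.1, fun a ha hf => hs.2 a ha (h hf)⟩

theorem Supported.mono {φ ψ : Set Name} {K : St} (h : φ ⊆ ψ) (hK : Supported φ K) :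
    Supported ψ K :=
  ⟨fun p hp => h (hK.thr p hp), fun p hp => h (hK.val p hp),
    fun q E p hq => ⟨h (hK.cont q E p hq).1, h (hK.cont q E p hq).2⟩⟩

theorem Supported.step {φ : Set Name} {K K' : St} {e : Event} (hK : Supported φ K)
    (h : BStep K e K') : Supported (φ ∪ {a | a ∈ e.1.bound}) K' := by
  obtain ⟨h1, h2, h3⟩ := hK
  cases h with
  | @PA p M V x h r =>
    refine ⟨?_, ?_, ?_⟩ <;> simp only [Function.update_apply, Action.bound] <;> grind
  | @PQ p M E x V y q h r hq =>
    have := h1 p (by simp [h])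
    refine ⟨?_, ?_, ?_⟩ <;> simp only [Function.update_apply, Action.bound] <;> grind
  | @OA q p E x h r =>
    have := h3 _ _ _ h
    refine ⟨?_, ?_, ?_⟩ <;> simp only [Function.update_apply, Action.bound] <;> grind
  | @OQ x V y p h r =>
    refine ⟨?_, ?_, ?_⟩ <;> simp only [Function.update_apply, Action.bound] <;> grind
  | @IOQ M p h r =>
    refine ⟨?_, ?_, ?_⟩ <;> simp only [Function.update_apply, Action.bound] <;> grind

theorem Supported.run {φ : Set Name} {K K' : St} {s : List Event} (hK : Supported φ K)
    (h : Run K s K') : Supported (φ ∪ {a | a ∈ (actions s).bound}) K' := by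
  induction s generalizing K φ with
  | nil => cases h; exact hK.mono (by simp)
  | cons e s ih =>
    obtain ⟨K₁, a, b⟩ := h
    refine (ih (hK.step a) b).mono ?_
    intro c
    simp only [actions_cons, bound_cons, Set.mem_union, Set.mem_ofPred_eq, List.mem_append]
    tauto

/-- Only a Player question binding `q` can store a continuation at `q`. -/
theorem Run.not_answers {K K' : St} {s : List Event} {q : Cont} (h : Run K s K')
    (hq : K.cont q = none) (hs : Name.cont q ∉ (actions s).bound) :
    ∀ e ∈ s, ∀ x, e.1 ≠ .ansO q x := by
  induction s generalizing K with
  | nil => simp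
  | cons e s ih =>
    obtain ⟨K₁, a, b⟩ := h
    rw [actions_cons, bound_cons, List.mem_append, not_or] at hs
    have h1 : (∀ x, e.1 ≠ .ansO q x) ∧ K₁.cont q = none := by
      cases a <;> simp_all [Action.bound, Function.update_apply]; grind
    intro e' he'
    rcases List.mem_cons.1 he' with rfl | he'
    · exact h1.1
    · exact ih b h1.2 hs.2 e' he'

theorem Run.not_asks {K K' : St} {s : List Event} {x : Var} (h : Run K s K')
    (hx : K.val x = none) (hs : Name.var x ∉ (actions s).bound) :
    ∀ e ∈ s, ∀ y p, e.1 ≠ .questO x y p := by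
  induction s generalizing K with
  | nil => simp
  | cons e s ih =>
    obtain ⟨K₁, a, b⟩ := h
    rw [actions_cons, bound_cons, List.mem_append, not_or] at hs
    have h1 : (∀ y p, e.1 ≠ .questO x y p) ∧ K₁.val x = none := by
      cases a <;> simp_all [Action.bound]; grind
    intro e' he'
    rcases List.mem_cons.1 he' with rfl | he'
    · exact h1.1
    · exact ih b h1.2 hs.2 e' he'

theorem mem_bound_actions {s : List Event} {e : Event} (he : e ∈ s) {a : Name}
    (ha : a ∈ e.1.bound) : a ∈ (actions s).bound :=
  List.mem_flatMap.2 ⟨e.1, List.mem_map_of_mem he, ha⟩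

theorem avoids_of {X Y : Set Cont} {Z : Set Var} {s : List Event}
    (hX : ∀ e ∈ s, e.2 ∉ X)
    (hY : ∀ q ∈ Y, Name.cont q ∉ (actions s).bound ∧ ∀ e ∈ s, ∀ x, e.1 ≠ .ansO q x)
    (hZ : ∀ x ∈ Z, Name.var x ∉ (actions s).bound ∧ ∀ e ∈ s, ∀ y p, e.1 ≠ .questO x y p) :
    ∀ e ∈ s, Avoids X Y Z e := by
  rintro ⟨a, t⟩ he
  refine ⟨hX _ he, ?_⟩
  cases a with
  | ansP p x => exact fun h => (hZ x h).1 (mem_bound_actions he (by simp [Action.bound]))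
  | ansO p x => exact fun h => (hY p h).2 _ he x rfl
  | questP z x q =>
    exact ⟨fun h => (hZ x h).1 (mem_bound_actions he (by simp [Action.bound])),
      fun h => (hY q h).1 (mem_bound_actions he (by simp [Action.bound]))⟩
  | questO z x q => exact fun h => (hZ z h).2 _ he _ _ rfl
  | init => trivial

/-! ### Alternation, bracketing and the states of Well-Bracketed OGS. -/

/-- Moves alternate, starting with Player (`true`) or Opponent (`false`). -/
def AltTrace : Bool → Trace → Bool → Prop
  | b, [], b' => b = b'
  | b, a :: s, b' => a.IsPlayer = b ∧ AltTrace (!b) s b'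

theorem AltTrace.append {b b' b'' : Bool} {s t : Trace} (h : AltTrace b s b')
    (h' : AltTrace b' t b'') : AltTrace b (s ++ t) b'' := by
  induction s generalizing b with
  | nil => cases h; exact h'
  | cons a s ih => exact ⟨h.1, ih h.2⟩

theorem PushdownTrace.append {σ σ' σ'' : Stack} {s t : Trace} (h : PushdownTrace σ s σ')
    (h' : PushdownTrace σ' t σ'') : PushdownTrace σ (s ++ t) σ'' := by
  induction s generalizing σ with
  | nil => cases h; exact h'
  | cons a s ih =>
    obtain ⟨σ₁, h1, h2⟩ := h
    exact ⟨σ₁, h1, ih h2⟩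

/-- `K` is a state of Well-Bracketed OGS with stack `σ`, where Player is to move if `b` is true. -/
structure WBState (φ : Set Name) (K : St) (b : Bool) (σ : Stack) : Prop where
  supp : Supported φ K
  nodup : σ.Nodup
  stack : ∀ q, q ∈ σ ↔ K.cont q ≠ none
  passive : b = false → ∀ p, K.thr p = none
  active : b = true → ∃ p, K.thr p ≠ none ∧ ∀ r, K.thr r ≠ none → r = p

theorem WBState.step {φ : Set Name} {K K' : St} {b : Bool} {σ σ' : Stack} {e : Event}
    (hK : WBState φ K b σ) (h : BStep K e K') (hb : e.1.IsPlayer = b)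
    (hσ : PushdownStep σ e.1 σ') : WBState (φ ∪ {a | a ∈ e.1.bound}) K' (!b) σ' := by
  have hs := hK.supp.step h
  obtain ⟨-, h2, h3, h4, h5⟩ := hK
  cases h with
  | PA h r =>
    cases hσ
    subst hb
    refine ⟨hs, h2, h3, fun _ t => ?_, by simp [Action.IsPlayer]⟩
    obtain ⟨p', hp', hu⟩ := h5 rfl
    simp only [Function.update_apply]
    grind
  | PQ h r hq =>
    cases hσ
    subst hb
    refine ⟨hs, ?_, ?_, fun _ t => ?_, by simp [Action.IsPlayer]⟩
    · simp_all
    · intro t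
      simp only [Function.update_apply, List.mem_cons]
      grind
    obtain ⟨p', hp', hu⟩ := h5 rfl
    simp only [Function.update_apply]
    grind
  | @OA q p E x h r =>
    cases hσ
    subst hb
    refine ⟨hs, ?_, ?_, by simp [Action.IsPlayer], fun _ => ⟨p, by simp, fun t => ?_⟩⟩
    · simp_all
    · intro t
      have := h3 t
      simp only [Function.update_apply]
      simp only [List.nodup_cons] at h2
      grind
    · simp only [Function.update_apply]
      have := h4 rfl t
      grind
  | @OQ x V y p h r =>
    cases hσ
    subst hb
    refine ⟨hs, h2, h3, by simp [Action.IsPlayer], fun _ => ⟨p, by simp, fun t => ?_⟩⟩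
    simp only [Function.update_apply]
    have := h4 rfl t
    grind
  | @IOQ M p h r =>
    cases hσ
    subst hb
    refine ⟨hs, h2, h3, by simp [Action.IsPlayer], fun _ => ⟨p, by simp, fun t => ?_⟩⟩
    simp only [Function.update_apply]
    have := h4 rfl t
    grind

theorem WBState.mono {φ ψ : Set Name} {K : St} {b : Bool} {σ : Stack} (h : φ ⊆ ψ)
    (hK : WBState φ K b σ) : WBState ψ K b σ :=
  { hK with supp := hK.supp.mono h }

theorem union_bound_cons (φ : Set Name) (a : Action) (s : Trace) :
    φ ∪ {b | b ∈ a.bound} ∪ {b | b ∈ s.bound} = φ ∪ {b | b ∈ Trace.bound (a :: s)} := by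
  ext c
  simp only [bound_cons, Set.mem_union, Set.mem_ofPred_eq, List.mem_append]
  tauto

theorem WBState.run {φ : Set Name} {K K' : St} {b b' : Bool} {σ σ' : Stack} {s : List Event}
    (hK : WBState φ K b σ) (h : Run K s K') (hb : AltTrace b (actions s) b')
    (hσ : PushdownTrace σ (actions s) σ') :
    WBState (φ ∪ {a | a ∈ (actions s).bound}) K' b' σ' := by
  induction s generalizing K φ b σ with
  | nil => cases h; cases hb; cases hσ; exact hK.mono (by simp)
  | cons e s ih =>
    obtain ⟨K₁, h1, h2⟩ := h
    obtain ⟨σ₁, h3, h4⟩ := hσ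
    rw [actions_cons, ← union_bound_cons]
    exact ih (hK.step h1 hb.1 h3) h2 hb.2 h4

/-! ### Splitting off the next well-bracketed block of a run. -/

theorem exists_split {α : Type*} (P : α → Prop) {s : List α} (h : ∃ e ∈ s, P e) :
    ∃ u e v, s = u ++ e :: v ∧ P e ∧ ∀ c ∈ u, ¬ P c := by
  induction s with
  | nil => simp at h
  | cons a s ih =>
    by_cases ha : P a
    · exact ⟨[], a, s, rfl, ha, by simp⟩
    · obtain ⟨e, he, hP⟩ := h
      rcases List.mem_cons.1 he with rfl | he
      · exact absurd hP ha
      · obtain ⟨u, e, v, rfl, h1, h2⟩ := ih ⟨e, he, hP⟩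
        refine ⟨a :: u, e, v, rfl, h1, ?_⟩
        intro c hc
        rcases List.mem_cons.1 hc with rfl | hc
        · exact ha
        · exact h2 c hc

theorem Run.thr_eq {K K' : St} {s : List Event} {p : Cont} (h : Run K s K')
    (hs : ∀ e ∈ s, e.2 ≠ p) : K'.thr p = K.thr p :=
  (h.agreeOn (X := {p}) (Y := ∅) (Z := ∅) (by
    intro e he
    refine ⟨hs e he, ?_⟩
    cases e.1 <;> simp)).1 p rfl

/-- In a run that ends the thread at `p`, its first move is a Player action. -/
theorem Run.exists_player {K K' : St} {s : List Event} {p : Cont} (h : Run K s K')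
    (hp : K.thr p ≠ none) (hp' : K'.thr p = none) :
    ∃ u a v K₁ K₂, s = u ++ (a, p) :: v ∧ a.IsPlayer = true ∧ (∀ e ∈ u, e.2 ≠ p) ∧
      Run K u K₁ ∧ BStep K₁ (a, p) K₂ ∧ Run K₂ v K' := by
  have hex : ∃ e ∈ s, e.2 = p := by
    by_contra! hc
    exact hp (h.thr_eq hc ▸ hp')
  obtain ⟨u, ⟨a, t⟩, v, rfl, rfl, hu⟩ := exists_split _ hex
  obtain ⟨K₁, h1, K₂, h2, h3⟩ := run_append.1 h
  refine ⟨u, a, v, K₁, K₂, rfl, ?_, hu, h1, h2, h3⟩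
  -- The thread at `p` is still running when its first event occurs, and every Opponent rule
  -- requires an idle thread.
  rw [← h1.thr_eq hu] at hp
  cases h2 <;> simp_all [Action.IsPlayer]

/-- Independence of a Player action from the events that precede it. -/
theorem Run.not_use_bound {φ : Set Name} {K K' : St} {u : List Event} {a : Action}
    (hK : Supported φ K) (h : Run K u K') (hf : Fresh φ (actions u ++ [a])) :
    (∀ q ∈ a.contBound, Name.cont q ∉ (actions u).bound ∧ ∀ e ∈ u, ∀ x, e.1 ≠ .ansO q x) ∧
    ∀ x ∈ a.varBound, Name.var x ∉ (actions u).bound ∧ ∀ e ∈ u, ∀ y p, e.1 ≠ .questO x y p := by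
  have hf' := (fresh_append.1 hf).2.2
  have hb : Trace.bound [a] = a.bound := by simp [Trace.bound]
  simp only [hb, Set.mem_union, Set.mem_ofPred_eq, not_or] at hf'
  refine ⟨fun q hq => ?_, fun x hx => ?_⟩
  · have h1 := hf' _ hq
    refine ⟨h1.2, h.not_answers ?_ h1.2⟩
    by_contra hc
    obtain ⟨⟨E, p⟩, hE⟩ := Option.ne_none_iff_exists'.1 hc
    exact h1.1 (hK.cont _ _ _ hE).1
  · have h1 := hf' _ hx
    refine ⟨h1.2, h.not_asks ?_ h1.2⟩
    by_contra hc
    exact h1.1 (hK.val _ hc)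

/-- The next block of moves of the well-bracketed serialization of the run `s`. -/
structure Block (F : St) (b : Bool) (σ : Stack) (s : List Event) (K : St) (β rest : List Event)
    (F' : St) (b' : Bool) (σ' : Stack) : Prop where
  ne_nil : β ≠ []
  perm : (β ++ rest).Perm s
  run : Run F β F'
  run_rest : Run F' rest K
  alt : AltTrace b (actions β) b'
  pushdown : PushdownTrace σ (actions β) σ'
  -- Undoing the reordering must be possible in any state of the same shape, since it is performed
  -- in `G` rather than in `F`.
  back : ∀ G G' L, SameShape F G → Run G β G' → Run G' rest L → Run G s L

theorem perm_middle_append {α : Type*} (u v : List α) (a : α) :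
    ([a] ++ (u ++ v)).Perm (u ++ a :: v) := by
  simpa using List.perm_middle.symm

theorem PushdownStep.of_player {φ : Set Name} {F F' : St} {b : Bool} {σ : Stack} {a : Action}
    {p : Cont} (hF : WBState φ F b σ) (ha : a.IsPlayer = true) (h : BStep F (a, p) F') :
    ∃ σ', PushdownStep σ a σ' := by
  cases h with
  | PA => exact ⟨_, .PA⟩
  | PQ _ _ hq => exact ⟨_, .PQ (by rw [hF.stack]; simpa using hq)⟩
  | OA => simp [Action.IsPlayer] at ha
  | OQ => simp [Action.IsPlayer] at ha
  | IOQ => simp [Action.IsPlayer] at ha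

/-- Terminality provides the events to be moved: every running thread must be stopped and every
stored continuation answered. Crossing earlier events is allowed because the names bound by the
moved Player action are fresh, and because `q`, when answered, is used by none of the events
crossed. -/
theorem WBState.exists_block {φ : Set Name} {F K : St} {b : Bool} {σ : Stack} {s : List Event}
    (hF : WBState φ F b σ) (hs : Fresh φ (actions s)) (hr : Run F s K) (hK : Terminal K)
    (hne : s ≠ []) : ∃ β rest F' b' σ', Block F b σ s K β rest F' b' σ' := by
  cases b with
  | true =>
    obtain ⟨p, hp, -⟩ := hF.active rfl
    obtain ⟨u, a, v, K₁, K₂, rfl, ha, hu, h1, h2, h3⟩ := hr.exists_player hp (hK.1 p)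
    have hfr : Fresh φ (actions u ++ [a]) := by
      have : actions (u ++ (a, p) :: v) = (actions u ++ [a]) ++ actions v := by
        simp [actions]
      rw [this] at hs
      exact (fresh_append.1 hs).1
    obtain ⟨hY, hZ⟩ := h1.not_use_bound hF.supp hfr
    have hav : ∀ e ∈ u, Avoids {p} a.contBound a.varBound e :=
      avoids_of (fun e he => by simpa using hu e he) hY hZ
    obtain ⟨F', h4, h5⟩ := player_move_front ha hav h1 h2
    obtain ⟨σ', hσ'⟩ := PushdownStep.of_player hF ha h4
    refine ⟨[(a, p)], u ++ v, F', false, σ', by simp, perm_middle_append _ _ _, ⟨_, h4, rfl⟩,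
      run_append.2 ⟨_, h5, h3⟩, ⟨ha, rfl⟩, ⟨_, hσ', rfl⟩, ?_⟩
    rintro G G' L - ⟨_, h6, rfl⟩ h7
    obtain ⟨G₂, h8, h9⟩ := run_append.1 h7
    obtain ⟨G₁, h10, h11⟩ := player_move_back ha hav h6 h8
    exact run_append.2 ⟨_, h10, _, h11, h9⟩
  | false =>
    cases σ with
    | nil =>
      cases s with
      | nil => exact absurd rfl hne
      | cons e v =>
        obtain ⟨F', h1, h2⟩ := hr
        have hth := hF.passive rfl
        -- With no thread and no stored continuation, only Opponent questions and the initial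
        -- question are possible, and these leave the stack unchanged.
        have hco : ∀ q, F.cont q = none := by
          intro q
          have := hF.stack q
          simpa using this
        have hO : e.1.IsPlayer = false ∧ PushdownStep [] e.1 [] := by
          cases h1 with
          | PA h => simp [hth] at h
          | PQ h => simp [hth] at h
          | OA h => simp [hco] at h
          | OQ => exact ⟨rfl, .OQ⟩
          | IOQ => exact ⟨rfl, .IOQ⟩
        refine ⟨[e], v, F', true, [], by simp, by simp, ⟨_, h1, rfl⟩, h2, ⟨hO.1, rfl⟩,
          ⟨_, hO.2, rfl⟩, ?_⟩
        rintro G G' L - ⟨_, h6, rfl⟩ h7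
        exact ⟨_, h6, h7⟩
    | cons q σ =>
      have hq : F.cont q ≠ none := (hF.stack q).1 (by simp)
      have hqφ : Name.cont q ∈ φ := by
        obtain ⟨⟨E, p⟩, hE⟩ := Option.ne_none_iff_exists'.1 hq
        exact (hF.supp.cont _ _ _ hE).1
      have hqs : Name.cont q ∉ (actions s).bound := fun h => hs.2 _ h hqφ
      -- Being in the support, `q` is never rebound. Were it never answered either, its continuation
      -- would survive to the end of the run.
      have hex : ∃ e ∈ s, ∃ x, e.1 = Action.ansO q x := by
        by_contra! hc
        have := (hr.agreeOn (X := ∅) (Y := {q}) (Z := ∅) (avoids_of (by simp)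
          (by rintro _ rfl; exact ⟨hqs, hc⟩) (by simp))).2.1 q rfl
        exact hq (this ▸ hK.2 q)
      obtain ⟨u, ⟨_, p⟩, v, rfl, ⟨x, rfl⟩, hu⟩ := exists_split _ hex
      obtain ⟨K₁, h1, K₂, h2, h3⟩ := run_append.1 hr
      have hp1 : K₁.thr p = none ∧ K₂.thr p ≠ none := by
        cases h2 with
        | OA _ h => simpa using h
      obtain ⟨w, a, v', K₃, K₄, rfl, ha, hw, h4, h5, h6⟩ := h3.exists_player hp1.2 (hK.1 p)
      have e1 : actions (u ++ (Action.ansO q x, p) :: (w ++ (a, p) :: v')) =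
          (actions u ++ [Action.ansO q x]) ++ ((actions w ++ [a]) ++ actions v') := by
        simp [actions]
      have hs0 := hs
      rw [e1, fresh_append, fresh_append (s := actions w ++ [a])] at hs
      have hsup : Supported (φ ∪ {c | c ∈ (actions u ++ [Action.ansO q x]).bound}) K₂ := by
        have := hF.supp.run (run_append (t := [(.ansO q x, p)]).2 ⟨_, h1, _, h2, rfl⟩)
        simpa [actions] using this
      obtain ⟨hY, hZ⟩ := h4.not_use_bound hsup hs.2.1
      have hav : ∀ e ∈ w, Avoids {p} a.contBound a.varBound e :=
        avoids_of (fun e he => by simpa using hw e he) hY hZ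
      -- The Player action is moved left across `w` to stand next to the answer. The pair then
      -- crosses `u`.
      obtain ⟨K₂', h7, h8⟩ := player_move_front ha hav h4 h5
      have hfu : Fresh φ (actions u ++ [a]) := by
        have hperm : (actions (u ++ (Action.ansO q x, p) :: (w ++ (a, p) :: v'))).Perm
            ((actions u ++ [a]) ++ (Action.ansO q x :: (actions w ++ actions v'))) := by
          rw [e1]
          simp only [List.append_assoc, List.cons_append, List.nil_append]
          refine List.Perm.append_left _ ?_
          refine List.Perm.trans (List.Perm.cons _ List.perm_middle) (List.Perm.swap _ _ _)
        exact (fresh_append.1 (hs0.perm hperm)).1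
      obtain ⟨hY', hZ'⟩ := h1.not_use_bound hF.supp hfu
      have hqa : q ∉ a.contBound := by
        intro h
        refine hqs ?_
        refine mem_bound_actions (e := (a, p)) (by simp) h
      have hav' : ∀ e ∈ u, Avoids ∅ (insert q a.contBound) a.varBound e := by
        refine avoids_of (by simp) ?_ hZ'
        rintro r (rfl | hr')
        · refine ⟨fun h => hqs ?_, fun e he y => ?_⟩
          · rw [actions_append, bound_append, List.mem_append]
            exact .inl h
          · exact fun h => hu e he ⟨y, h⟩
        · exact hY' r hr'
      obtain ⟨F', h9, h10⟩ := answer_move_front ha hqa hav' (hF.passive rfl p) h1 h2 h7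
      have h9' := h9
      obtain ⟨F₁, h11, F₂, h12, rfl⟩ := h9'
      have hW := hF.step h11 rfl .OA
      obtain ⟨σ', hσ'⟩ := PushdownStep.of_player hW ha h12
      refine ⟨[(.ansO q x, p), (a, p)], u ++ (w ++ v'), F₂, false, σ', by simp, ?_, h9,
        run_append.2 ⟨_, h10, run_append.2 ⟨_, h8, h6⟩⟩, ⟨rfl, ha, rfl⟩,
        ⟨_, .OA, _, hσ', rfl⟩, ?_⟩
      · refine List.Perm.trans ?_ List.perm_middle.symm
        refine List.Perm.cons _ ?_
        refine List.Perm.trans ?_ (List.Perm.append_left _ List.perm_middle.symm)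
        exact perm_middle_append _ _ _
      · intro G G' L hsh h13 h14
        obtain ⟨G₂, h15, h16⟩ := run_append.1 h14
        obtain ⟨G₃, h17, h18⟩ := run_append.1 h16
        obtain ⟨G₁, h19, h20⟩ := answer_move_back ha hqa hav' h13 h15
        -- Running `u` in `F` and in `G` preserves equality of shapes, so `p` is idle in `G` too
        -- where the answer is reinserted.
        have hsh' := hsh.run h1 h19
        obtain ⟨H, h21, _, h22, rfl⟩ := h20 ((hsh'.1 p).1 hp1.1)
        obtain ⟨H', h23, h24⟩ := player_move_back ha hav h22 h17
        exact run_append.2 ⟨_, h19, _, h21, run_append.2 ⟨_, h23, _, h24, h18⟩⟩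

/-! ### Serialization, and transfer from well-bracketed to arbitrary runs. -/

/-- `K` has a run over the trace `s` to a terminal state. -/
def Completes (K : St) (s : Trace) : Prop :=
  ∃ es K', actions es = s ∧ Run K es K' ∧ Terminal K'

/-- Alternating and well-bracketed from `σ` to the empty stack. -/
def WellBracketed (b : Bool) (σ : Stack) (s : Trace) : Prop :=
  (∃ b', AltTrace b s b') ∧ PushdownTrace σ s []

/-- Well-bracketed terminating traces of `F` are terminating traces of `G`. -/
def WBIncl (φ : Set Name) (b : Bool) (σ : Stack) (F G : St) : Prop :=
  ∀ s : Trace, Fresh φ s → WellBracketed b σ s → Completes F s → Completes G s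

theorem actions_perm {s t : List Event} (h : s.Perm t) : (actions s).Perm (actions t) := h.map _

theorem Block.fresh {φ : Set Name} {F F' K : St} {b b' : Bool} {σ σ' : Stack}
    {s β rest : List Event} (h : Block F b σ s K β rest F' b' σ') (hs : Fresh φ (actions s)) :
    Fresh φ (actions β) ∧ Fresh (φ ∪ {a | a ∈ (actions β).bound}) (actions rest) := by
  rw [← fresh_append, ← actions_append]
  exact hs.perm (actions_perm h.perm).symm

theorem Block.length_lt {F F' K : St} {b b' : Bool} {σ σ' : Stack}
    {s β rest : List Event} (h : Block F b σ s K β rest F' b' σ') : rest.length < s.length := by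
  rw [← h.perm.length_eq, List.length_append]
  have := List.length_pos_iff.2 h.ne_nil
  omega

theorem WBState.exists_serial {φ : Set Name} {F K : St} {b : Bool} {σ : Stack} {s : List Event}
    (hF : WBState φ F b σ) (hs : Fresh φ (actions s)) (hr : Run F s K) (hK : Terminal K) :
    ∃ w, w.Perm s ∧ Run F w K ∧ WellBracketed b σ (actions w) := by
  induction hn : s.length using Nat.strong_induction_on generalizing φ F b σ s with
  | _ n ih =>
  by_cases hne : s = []
  · subst hne
    cases hr
    refine ⟨[], .nil, rfl, ⟨b, rfl⟩, ?_⟩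
    -- The state is itself terminal, and the stack lists the stored continuations.
    refine List.eq_nil_iff_forall_not_mem.2 fun q => ?_
    simpa [hF.stack] using hK.2 q
  · obtain ⟨β, rest, F', b', σ', hB⟩ := hF.exists_block hs hr hK hne
    obtain ⟨w, h1, h2, ⟨c, h3⟩, h4⟩ := ih _ (hn ▸ hB.length_lt)
      (hF.run hB.run hB.alt hB.pushdown) (hB.fresh hs).2 hB.run_rest rfl
    refine ⟨β ++ w, (h1.append_left β).trans hB.perm, run_append.2 ⟨_, hB.run, h2⟩, ⟨c, ?_⟩, ?_⟩
    · rw [actions_append]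
      exact hB.alt.append h3
    · rw [actions_append]
      exact hB.pushdown.append h4

/-- Only two kinds of action do not display their thread. A Player question comes from the unique
running thread, and an Opponent answer resumes the thread given by the continuation structure. -/
theorem SameShape.thread_eq {φ : Set Name} {F G F' G' : St} {b : Bool} {σ : Stack} {a : Action}
    {t t' : Cont} (h : SameShape F G) (hF : WBState φ F b σ) (hb : a.IsPlayer = b)
    (h₁ : BStep F (a, t) F') (h₂ : BStep G (a, t') G') : t' = t := by
  cases h₁ with
  | PA => cases h₂; rfl
  | PQ h3 =>
    cases h₂ with
    | PQ h4 =>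
      obtain ⟨p, -, hp⟩ := hF.active hb.symm
      rw [hp t (by simp [h3]), hp t' (by rw [Ne, h.1]; simp [h4])]
  | OA h3 =>
    cases h₂ with
    | OA h4 =>
      obtain ⟨E, hE⟩ := h.cont_eq h3
      rw [h4] at hE
      simp_all
  | OQ => cases h₂; rfl
  | IOQ => cases h₂; rfl

/-- Inclusion of well-bracketed traces is preserved by well-bracketed moves. -/
theorem WBIncl.step {φ : Set Name} {F G F' : St} {b : Bool} {σ σ' : Stack} {e : Event}
    {w : Trace} (hFG : WBIncl φ b σ F G) (hF : WBState φ F b σ)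
    (hsh : SameShape F G) (h : BStep F e F') (hb : e.1.IsPlayer = b)
    (hσ : PushdownStep σ e.1 σ') (hf : Fresh φ (e.1 :: w)) (hw : WellBracketed (!b) σ' w)
    (hc : Completes F' w) :
    ∃ G', BStep G e G' ∧ SameShape F' G' ∧
      WBIncl (φ ∪ {a | a ∈ e.1.bound}) (!b) σ' F' G' := by
  have key : ∀ s, Fresh φ (e.1 :: s) → WellBracketed (!b) σ' s → Completes F' s →
      ∃ G', BStep G e G' ∧ Completes G' s := by
    rintro s hs ⟨⟨c, hs1⟩, hs2⟩ ⟨es, K, rfl, h1, h2⟩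
    obtain ⟨es', L, h3, h4, h5⟩ := hFG (e.1 :: actions es) hs
      ⟨⟨c, hb, hs1⟩, ⟨_, hσ, hs2⟩⟩ ⟨e :: es, K, rfl, ⟨_, h, h1⟩, h2⟩
    cases es' with
    | nil => simp [actions] at h3
    | cons e' es' =>
      obtain ⟨G', h6, h7⟩ := h4
      simp only [actions_cons, List.cons.injEq] at h3
      have : e' = e := by
        obtain ⟨a, t⟩ := e
        obtain ⟨a', t'⟩ := e'
        obtain rfl : a' = a := h3.1
        rw [hsh.thread_eq hF hb h h6]
      subst this
      exact ⟨G', h6, es', L, h3.2, h7, h5⟩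
  -- The trace `w` only shows that `G` can perform `e`. For other continuations `s`, determinism
  -- gives the same `G'`.
  obtain ⟨G', h1, -⟩ := key w hf hw hc
  refine ⟨G', h1, hsh.step h h1, fun s hs hsw hsc => ?_⟩
  obtain ⟨G₂, h2, h3⟩ := key s (fresh_cons.2 ⟨(fresh_cons.1 hf).1, hs⟩) hsw hsc
  rwa [h1.unique h2]

theorem WBIncl.run {φ : Set Name} {F G F' : St} {b b' : Bool} {σ σ' : Stack} {β : List Event}
    {w : Trace} (hFG : WBIncl φ b σ F G) (hF : WBState φ F b σ)
    (hsh : SameShape F G) (h : Run F β F') (hb : AltTrace b (actions β) b')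
    (hσ : PushdownTrace σ (actions β) σ') (hf : Fresh φ (actions β ++ w))
    (hw : WellBracketed b' σ' w) (hc : Completes F' w) :
    ∃ G', Run G β G' ∧ SameShape F' G' ∧
      WBIncl (φ ∪ {a | a ∈ (actions β).bound}) b' σ' F' G' := by
  induction β generalizing φ F G b σ with
  | nil =>
    cases h; cases hb; cases hσ
    exact ⟨G, rfl, hsh, by simpa [actions, Trace.bound] using hFG⟩
  | cons e β ih =>
    obtain ⟨F₁, h1, h2⟩ := h
    obtain ⟨σ₁, h3, h4⟩ := hσ
    obtain ⟨⟨c, hw1⟩, hw2⟩ := hw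
    obtain ⟨es, K, rfl, h5, h6⟩ := hc
    obtain ⟨G₁, h7, h8, h9⟩ := hFG.step hF hsh h1 hb.1 h3 hf
      ⟨⟨c, hb.2.append hw1⟩, h4.append hw2⟩
      ⟨β ++ es, K, actions_append _ _, run_append.2 ⟨_, h2, h5⟩, h6⟩
    obtain ⟨G', h10, h11, h12⟩ := ih h9 (hF.step h1 hb.1 h3) h8 h2 hb.2 h4 (fresh_cons.1 hf).2
    refine ⟨G', ⟨_, h7, h10⟩, h11, ?_⟩
    rwa [union_bound_cons] at h12

/-- Well-bracketed terminating traces determine all terminating traces. -/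
theorem WBIncl.run_of_run {φ : Set Name} {F G K : St} {b : Bool} {σ : Stack} {s : List Event}
    (hFG : WBIncl φ b σ F G) (hF : WBState φ F b σ) (hsh : SameShape F G)
    (hs : Fresh φ (actions s)) (hr : Run F s K) (hK : Terminal K) :
    ∃ L, Run G s L ∧ Terminal L := by
  induction hn : s.length using Nat.strong_induction_on generalizing φ F G b σ s with
  | _ n ih =>
  by_cases hne : s = []
  · subst hne
    cases hr
    refine ⟨G, rfl, fun p => (hsh.1 p).1 (hK.1 p), fun q => ?_⟩
    have := hsh.2 q
    rw [hK.2 q] at this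
    simpa using this.symm
  · obtain ⟨β, rest, F', b', σ', hB⟩ := hF.exists_block hs hr hK hne
    have hF' := hF.run hB.run hB.alt hB.pushdown
    have hfr := hB.fresh hs
    -- The serialization `w` only completes `β` to a trace to which the inclusion applies. The
    -- induction then runs on `rest` in its original order.
    obtain ⟨w, hw1, hw2, hw3⟩ := hF'.exists_serial hfr.2 hB.run_rest hK
    obtain ⟨G', h1, h2, h3⟩ := hFG.run hF hsh hB.run hB.alt hB.pushdown
      (fresh_append.2 ⟨hfr.1, hfr.2.perm (actions_perm hw1).symm⟩) hw3 ⟨w, K, rfl, hw2, hK⟩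
    obtain ⟨L, h4, h5⟩ := ih _ (hn ▸ hB.length_lt) h3 hF' h2 hfr.2 hB.run_rest rfl
    exact ⟨L, hB.back G G' L hsh h1 h4, h5⟩

/-! Pending continuation names and terminal states. -/

noncomputable def St.pend (K : St) : Cont → ℕ :=
  pendingOf {p | ∃ M, K.thr p = some M} ⟨K.val, K.cont⟩

/-- The continuations of `K` that return to `r`. -/
def St.returning (K : St) (r : Cont) : Set Cont := {q | ∃ E, K.cont q = some (E, r)}

open Classical in
theorem St.pend_eq (K : St) (r : Cont) :
    K.pend r = (if K.thr r = none then 0 else 1) + (if K.cont r = none then 0 else 1) +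
      (K.returning r).ncard := by
  have h1 : (∃ M, K.thr r = some M) ↔ ¬ K.thr r = none := by
    rw [← Option.ne_none_iff_exists']
  have h2 : Name.cont r ∈ Env.dom ⟨K.val, K.cont⟩ ↔ ¬ K.cont r = none := by
    rw [← Ne, Option.ne_none_iff_exists']
    simp [Env.dom]
  have h3 : {q : Cont | (q, r) ∈ Env.cs ⟨K.val, K.cont⟩} = K.returning r := rfl
  simp only [St.pend, pendingOf, h2, h3, Set.mem_ofPred_eq, h1]
  split_ifs <;> simp_all

theorem St.pend_eq_zero_iff (K : St) : (∀ r, K.pend r = 0) ↔ Terminal K := by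
  classical
  constructor
  · intro h
    refine ⟨fun r => ?_, fun r => ?_⟩ <;>
    · have := h r
      rw [K.pend_eq] at this
      by_contra hc
      simp [hc] at this
  · rintro ⟨h1, h2⟩ r
    rw [K.pend_eq]
    have : K.returning r = ∅ := by
      ext q
      simp [St.returning, h2]
    simp [h1, h2, this]

def FiniteCont (K : St) : Prop := {q | K.cont q ≠ none}.Finite

theorem FiniteCont.returning {K : St} (h : FiniteCont K) (r : Cont) : (K.returning r).Finite :=
  h.subset fun q ⟨E, hq⟩ => by simp [hq]

theorem FiniteCont.step {K K' : St} {e : Event} (h : FiniteCont K) (hs : BStep K e K') :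
    FiniteCont K' := by
  cases hs with
  | PA => exact h
  | @PQ p M E x V y q =>
    refine (h.insert q).subset fun r hr => ?_
    simp only [Function.update_apply, ne_eq, Set.mem_ofPred_eq, Set.mem_insert_iff] at hr ⊢
    grind
  | @OA q p E x =>
    refine h.subset fun r hr => ?_
    simp only [Function.update_apply, ne_eq, Set.mem_ofPred_eq] at hr ⊢
    grind
  | OQ => exact h
  | IOQ => exact h

/-- Besides the names answered or introduced, only the toplevel `p` of a Player question or an
Opponent answer is affected, and there the changes cancel: a running thread at `p` is exchanged for
a continuation returning to `p`, or conversely. Finiteness makes `Set.ncard` a true count. -/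
theorem BStep.pend_add {K K' : St} {e : Event} (h : FiniteCont K) (hs : BStep K e K')
    (r : Cont) :
    K'.pend r + e.1.answered.count r = K.pend r + e.1.introduced.count r := by
  classical
  have hK := h.returning r
  simp only [St.pend_eq]
  cases hs with
  | @PA p M V x h1 h2 =>
    have : St.returning ⟨K.start, Function.update K.thr p none, Function.update K.val x (some V),
      K.cont⟩ r = K.returning r := rfl
    simp only [this, Action.answered, Action.introduced, Function.update_apply, List.count_singleton,
      List.count_nil]
    grind
  | @PQ p M E x V y q h1 h2 h3 =>
    simp only [Action.answered, Action.introduced, Function.update_apply, List.count_singleton,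
      List.count_nil]
    by_cases hr : r = p
    · subst hr
      have hq : q ∉ K.returning r := by simp [St.returning, h3]
      have : St.returning ⟨K.start, Function.update K.thr r none, Function.update K.val y (some V),
          Function.update K.cont q (some (E, r))⟩ r = insert q (K.returning r) := by
        ext t
        simp only [St.returning, Function.update_apply, Set.mem_ofPred_eq, Set.mem_insert_iff]
        by_cases ht : t = q
        · simp [ht]
        · simp [ht]
      rw [this, Set.ncard_insert_of_notMem hq hK]
      grind
    · have : St.returning ⟨K.start, Function.update K.thr p none, Function.update K.val y (some V),
          Function.update K.cont q (some (E, p))⟩ r = K.returning r := by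
        ext t
        simp only [St.returning, Function.update_apply, Set.mem_ofPred_eq]
        grind
      rw [this]
      grind
  | @OA q p E x h1 h2 =>
    simp only [Action.answered, Action.introduced, Function.update_apply, List.count_singleton,
      List.count_nil]
    by_cases hr : r = p
    · subst hr
      have hq : q ∈ K.returning r := ⟨E, h1⟩
      have : St.returning ⟨K.start, Function.update K.thr r (some (E.plug (.fvar x))), K.val,
          Function.update K.cont q none⟩ r = K.returning r \ {q} := by
        ext t
        simp only [St.returning, Function.update_apply, Set.mem_ofPred_eq, Set.mem_sdiff,
          Set.mem_singleton_iff]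
        grind
      rw [this]
      have := Set.ncard_sdiff_singleton_add_one hq hK
      grind
    · have : St.returning ⟨K.start, Function.update K.thr p (some (E.plug (.fvar x))), K.val,
          Function.update K.cont q none⟩ r = K.returning r := by
        ext t
        simp only [St.returning, Function.update_apply, Set.mem_ofPred_eq]
        grind
      rw [this]
      grind
  | @OQ x V y p h1 h2 =>
    have : St.returning ⟨K.start, Function.update K.thr p (some (.app V.1 (.fvar y))), K.val,
      K.cont⟩ r = K.returning r := rfl
    simp only [this, Action.answered, Action.introduced, Function.update_apply, List.count_singleton,
      List.count_nil]
    grind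
  | @IOQ M p h1 h2 =>
    have : St.returning ⟨none, Function.update K.thr p (some M), K.val,
      K.cont⟩ r = K.returning r := rfl
    simp only [this, Action.answered, Action.introduced, Function.update_apply, List.count_singleton,
      List.count_nil]
    grind

theorem Run.pend_add {K K' : St} {s : List Event} (h : FiniteCont K) (hs : Run K s K')
    (r : Cont) :
    K'.pend r + (actions s).answered.count r = K.pend r + (actions s).introduced.count r := by
  induction s generalizing K with
  | nil => cases hs; rfl
  | cons e s ih =>
    obtain ⟨K₁, h1, h2⟩ := hs
    have a := ih (h.step h1) h2
    have b := h1.pend_add h r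
    have c : (actions (e :: s)).answered = e.1.answered ++ (actions s).answered := rfl
    have d : (actions (e :: s)).introduced = e.1.introduced ++ (actions s).introduced := rfl
    rw [c, d, List.count_append, List.count_append]
    omega

theorem introduced_sublist (s : Trace) : ((Trace.introduced s).map Name.cont).Sublist s.bound := by
  induction s with
  | nil => exact .slnil
  | cons a s ih =>
    have h1 : Trace.introduced (a :: s) = a.introduced ++ Trace.introduced s := rfl
    rw [h1, List.map_append, bound_cons]
    refine List.Sublist.append ?_ ih
    cases a <;> simp [Action.introduced, Action.bound]

/-- A name introduced in `s` is introduced once and has `b r = 0`, so its answers and `e r` add up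
to one. For any other name, answers and `e r` add up to `b r`. Both clauses of completeness thus say
that nothing is left pending. -/
theorem answersAll_iff {s : Trace} {b e : Cont → ℕ} (hs : s.bound.Nodup)
    (hb : ∀ r, Name.cont r ∈ s.bound → b r = 0)
    (h : ∀ r, e r + s.answered.count r = b r + s.introduced.count r) :
    s.AnswersAll b ↔ ∀ r, e r = 0 := by
  have hsub := introduced_sublist s
  have hnd : s.introduced.Nodup := (hsub.nodup hs).of_map _
  have hb' : ∀ r ∈ s.introduced, b r = 0 := fun r hr =>
    hb r (hsub.subset (List.mem_map_of_mem hr))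
  have hu : ∀ r, s.unjustified.count r =
      if r ∈ s.introduced then 0 else s.answered.count r := by
    intro r
    split_ifs with hr
    · rw [List.count_eq_zero]
      simp [Trace.unjustified, hr]
    · exact List.count_filter (by simpa using hr)
  constructor
  · rintro ⟨h1, h2⟩ r
    have h3 := h r
    have h4 := h2 r
    rw [hu] at h4
    split_ifs at h4 with hr
    · have h5 := List.count_pos_iff.2 (h1 r hr)
      have h6 := List.nodup_iff_count_le_one.1 hnd r
      omega
    · rw [List.count_eq_zero.2 hr] at h3
      omega
  · intro he
    refine ⟨fun r hr => ?_, fun r => ?_⟩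
    · have h3 := h r
      have h5 := List.count_pos_iff.2 hr
      rw [← List.count_pos_iff]
      have := he r
      omega
    · have h3 := h r
      have := he r
      rw [hu]
      split_ifs with hr
      · exact (hb' r hr).symm
      · rw [List.count_eq_zero.2 hr] at h3
        omega

/-! Concurrent OGS in big-step form. -/

def CConf.toSt : CConf → St
  | .conf A γ _ => ⟨none, A, γ.val, γ.cont⟩
  | .init M _ => ⟨some M, fun _ => none, fun _ => none, fun _ => none⟩

theorem CConf.pending_eq (K : CConf) : K.pending = K.toSt.pend := by
  cases K with
  | conf => rfl
  | init M φ => simp [CConf.pending, St.pend, CConf.toSt, CConf.running, CConf.env, Env.empty]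

/-- `K` is obtained from `B` by reducing running terms. -/
structure Lag (K B : St) : Prop where
  start : K.start = B.start
  val : K.val = B.val
  cont : K.cont = B.cont
  none_iff : ∀ p, K.thr p = none ↔ B.thr p = none
  red : ∀ p M N, B.thr p = some M → K.thr p = some N → RedStar M N

theorem Lag.refl (K : St) : Lag K K :=
  ⟨rfl, rfl, rfl, fun _ => Iff.rfl, fun p M N h h' => by
    rw [h] at h'; cases h'; exact .refl⟩

theorem Lag.exists_red {K B : St} (h : Lag K B) {p : Cont} {N : Tm 0} (hp : K.thr p = some N) :
    ∃ M, B.thr p = some M ∧ RedStar M N := by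
  have : B.thr p ≠ none := fun hc => by simp [(h.none_iff p).2 hc] at hp
  obtain ⟨M, hM⟩ := Option.ne_none_iff_exists'.1 this
  exact ⟨M, hM, h.red p M N hM hp⟩

theorem Lag.tau {K K' : CConf} {B : St} (h : Lag K.toSt B) (hs : CStep K none K') :
    Lag K'.toSt B ∧ K'.supp = K.supp := by
  cases hs with
  | @tau A M N p γ φ hp hr =>
    obtain ⟨M', hM, hr'⟩ := h.exists_red hp
    refine ⟨⟨h.start, h.val, h.cont, fun r => ?_, fun r L L' h1 h2 => ?_⟩, rfl⟩
    · have := h.none_iff r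
      simp only [CConf.toSt, Function.update_apply] at this ⊢
      grind
    · have := h.red r L
      simp only [CConf.toSt, Function.update_apply] at this h2
      split_ifs at h2 with hq
      · subst hq
        cases h2
        rw [hM] at h1
        cases h1
        exact hr'.tail hr
      · exact this L' h1 h2

theorem Lag.tauStar {K K' : CConf} {B : St} (h : Lag K.toSt B) (hs : TauStar CStep K K') :
    Lag K'.toSt B ∧ K'.supp = K.supp := by
  induction hs with
  | refl => exact ⟨h, rfl⟩
  | tail _ h2 ih =>
    have := ih.1.tau h2
    exact ⟨this.1, this.2.trans ih.2⟩

/-- The delayed reductions of `B` are performed by its Player event, while a thread started by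
Opponent has no delay. The side conditions on names follow from freshness and `Supported`. -/
theorem Lag.step {K K' : CConf} {B : St} {l : Action} (h : Lag K.toSt B)
    (hB : Supported K.supp B) (hs : CStep K (some l) K') :
    ∃ t B', BStep B (l, t) B' ∧ Lag K'.toSt B' ∧ Fresh K.supp [l] ∧
      (K'.supp : Set Name) = ↑K.supp ∪ {a | a ∈ l.bound} := by
  cases hs with
  | @PA A V p γ φ x h1 h2 =>
    obtain ⟨M, hM, hr⟩ := h.exists_red h1
    refine ⟨p, _, .PA hM hr, ⟨h.start, ?_, h.cont, ?_, ?_⟩, ?_, ?_⟩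
    · rw [← h.val]; rfl
    · intro r
      have := h.none_iff r
      simp only [CConf.toSt, Function.update_apply] at this ⊢
      grind
    · intro r L L' h3 h4
      have := h.red r L L'
      simp only [CConf.toSt, Function.update_apply] at this h3 h4
      grind
    · simpa [Fresh, Trace.bound, Action.bound, CConf.supp] using h2
    · ext a; simp [CConf.supp, Action.bound]
  | @PQ A E x V p γ φ y q h1 h2 h3 =>
    obtain ⟨M, hM, hr⟩ := h.exists_red h1
    have hq : B.cont q = none := by
      by_contra hc
      obtain ⟨⟨E', r⟩, hE⟩ := Option.ne_none_iff_exists'.1 hc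
      exact h3 (hB.cont _ _ _ hE).1
    refine ⟨p, _, .PQ hM hr hq, ⟨h.start, ?_, ?_, ?_, ?_⟩, ?_, ?_⟩
    · rw [← h.val]; rfl
    · rw [← h.cont]; rfl
    · intro r
      have := h.none_iff r
      simp only [CConf.toSt, Function.update_apply] at this ⊢
      grind
    · intro r L L' h3 h4
      have := h.red r L L'
      simp only [CConf.toSt, Function.update_apply] at this h3 h4
      grind
    · simpa [Fresh, Trace.bound, Action.bound, CConf.supp] using ⟨h2, h3⟩
    · ext a; simp [CConf.supp, Action.bound]; tauto
  | @OA A γ φ p E q x h1 h2 h3 =>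
    have h4 : B.cont p = some (E, q) := by rw [← h.cont]; exact h1
    refine ⟨q, _, .OA h4 ((h.none_iff q).1 h2), ⟨h.start, h.val, ?_, ?_, ?_⟩, ?_, ?_⟩
    · rw [← h.cont]; rfl
    · intro r
      have := h.none_iff r
      simp only [CConf.toSt, Function.update_apply] at this ⊢
      grind
    · intro r L L' h3 h4
      have := h.red r L L'
      simp only [CConf.toSt, Function.update_apply] at this h3 h4
      split_ifs at h3 h4
      · cases h3; cases h4; exact .refl
      · exact this h3 h4
    · simpa [Fresh, Trace.bound, Action.bound, CConf.supp] using h3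
    · ext a; simp [CConf.supp, Action.bound]
  | @OQ A γ φ x V y p h1 h2 h3 =>
    have h4 : B.val x = some V := by rw [← h.val]; exact h1
    have hp : B.thr p = none := by
      by_contra hc
      exact h3 (hB.thr _ hc)
    refine ⟨p, _, .OQ h4 hp, ⟨h.start, h.val, h.cont, ?_, ?_⟩, ?_, ?_⟩
    · intro r
      have := h.none_iff r
      simp only [CConf.toSt, Function.update_apply] at this ⊢
      grind
    · intro r L L' h3 h4
      have := h.red r L L'
      simp only [CConf.toSt, Function.update_apply] at this h3 h4
      split_ifs at h3 h4
      · cases h3; cases h4; exact .refl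
      · exact this h3 h4
    · simpa [Fresh, Trace.bound, Action.bound, CConf.supp] using ⟨h2, h3⟩
    · ext a; simp [CConf.supp, Action.bound]; tauto
  | @IOQ M φ p h1 =>
    have hp : B.thr p = none := (h.none_iff p).1 rfl
    refine ⟨p, _, .IOQ h.start.symm hp, ⟨rfl, h.val, h.cont, ?_, ?_⟩, ?_, ?_⟩
    · intro r
      have := h.none_iff r
      simp only [CConf.toSt, Function.update_apply] at this ⊢
      grind
    · intro r L L' h3 h4
      have := h.red r L L'
      simp only [CConf.toSt, Function.update_apply] at this h3 h4
      split_ifs at h3 h4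
      · cases h3; cases h4; exact .refl
    · simpa [Fresh, Trace.bound, Action.bound, CConf.supp] using h1
    · ext a; simp [CConf.supp, Action.bound]

theorem Lag.run {K K' : CConf} {B : St} {s : Trace} (h : Lag K.toSt B)
    (hB : Supported K.supp B) (hs : WeakTrace CStep K s K') :
    ∃ es B', actions es = s ∧ Run B es B' ∧ Fresh K.supp s := by
  induction s generalizing K B with
  | nil => exact ⟨[], B, rfl, rfl, by simp [Fresh, Trace.bound]⟩
  | cons l s ih =>
    obtain ⟨K₃, ⟨K₁, K₂, h1, h2, h3⟩, h4⟩ := hs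
    obtain ⟨h5, e5⟩ := h.tauStar h1
    obtain ⟨t, B₁, h6, h7, h8, e8⟩ := h5.step (e5 ▸ hB) h2
    obtain ⟨h9, e9⟩ := h7.tauStar h3
    have e : (K₃.supp : Set Name) = ↑K.supp ∪ {a | a ∈ l.bound} := by rw [e9, e8, e5]
    obtain ⟨es, B', h10, h11, h12⟩ := ih h9 (e ▸ hB.step h6) h4
    refine ⟨(l, t) :: es, B', by rw [actions_cons, h10], ⟨_, h6, h11⟩, fresh_cons.2 ⟨?_, ?_⟩⟩
    · rwa [← e5]
    · rwa [← e]

theorem CConf.tauStar_update {A : Running} {γ : Env} {φ : Finset Name} {p : Cont} {M N : Tm 0}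
    (hp : A p = some M) (h : RedStar M N) :
    TauStar CStep (.conf A γ φ) (.conf (Function.update A p (some N)) γ φ) := by
  induction h with
  | refl => rw [← hp, Function.update_eq_self]; exact .refl
  | @tail L N _ h2 ih =>
    refine ih.tail ?_
    have := CStep.tau (A := Function.update A p (some L)) (γ := γ) (φ := φ) (p := p) (by simp) h2
    rwa [Function.update_idem] at this

theorem fresh_singleton {φ : Set Name} {a : Action} (h : Fresh φ [a]) : ∀ c ∈ a.bound, c ∉ φ := by
  intro c hc
  exact h.2 c (by simpa [Trace.bound] using hc)

theorem BStep.exists_weak {K : CConf} {B' : St} {e : Event} (h : BStep K.toSt e B')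
    (hf : Fresh K.supp [e.1]) :
    ∃ K', WeakStep CStep K e.1 K' ∧ K'.toSt = B' ∧
      (K'.supp : Set Name) = ↑K.supp ∪ {a | a ∈ e.1.bound} := by
  have hf := fresh_singleton hf
  cases K with
  | init M φ =>
    cases h with
    | PA h1 => simp [CConf.toSt] at h1
    | PQ h1 => simp [CConf.toSt] at h1
    | OA h1 => simp [CConf.toSt] at h1
    | OQ h1 => simp [CConf.toSt] at h1
    | @IOQ _ p h1 =>
      cases h1
      refine ⟨_, ⟨_, _, .refl, .IOQ ?_, .refl⟩, rfl, ?_⟩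
      · simpa [CConf.supp] using hf (.cont p) (by simp [Action.bound])
      · ext a; simp [CConf.supp, Action.bound]
  | conf A γ φ =>
    cases h with
    | @PA p M V x h1 h2 =>
      refine ⟨_, ⟨_, _, CConf.tauStar_update h1 h2, .PA (p := p) (x := x) (V := V) (by simp) ?_,
        .refl⟩, ?_, ?_⟩
      · simpa [CConf.supp] using hf (.var x) (by simp [Action.bound])
      · simp [CConf.toSt, Env.setVal]
      · ext a; simp [CConf.supp, Action.bound]
    | @PQ p M E x V y q h1 h2 h3 =>
      refine ⟨_, ⟨_, _, CConf.tauStar_update h1 h2, .PQ (p := p) (x := x) (V := V) (y := y)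
        (q := q) (E := E) (by simp) ?_ ?_, .refl⟩, ?_, ?_⟩
      · simpa [CConf.supp] using hf (.var y) (by simp [Action.bound])
      · simpa [CConf.supp] using hf (.cont q) (by simp [Action.bound])
      · simp [CConf.toSt, Env.setVal, Env.setCont]
      · ext a; simp [CConf.supp, Action.bound]; tauto
    | @OA q p E x h1 h2 =>
      refine ⟨_, ⟨_, _, .refl, .OA (x := x) h1 h2 ?_, .refl⟩, rfl, ?_⟩
      · simpa [CConf.supp] using hf (.var x) (by simp [Action.bound])
      · ext a; simp [CConf.supp, Action.bound]
    | @OQ x V y p h1 h2 =>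
      refine ⟨_, ⟨_, _, .refl, .OQ (y := y) (p := p) h1 ?_ ?_, .refl⟩, rfl, ?_⟩
      · simpa [CConf.supp] using hf (.var y) (by simp [Action.bound])
      · simpa [CConf.supp] using hf (.cont p) (by simp [Action.bound])
      · ext a; simp [CConf.supp, Action.bound]; tauto
    | IOQ h1 => simp [CConf.toSt] at h1

theorem Run.hasTrace {K : CConf} {B' : St} {s : List Event} (h : Run K.toSt s B')
    (hf : Fresh K.supp (actions s)) : HasTrace CStep K (actions s) := by
  induction s generalizing K with
  | nil => exact ⟨K, rfl⟩
  | cons e s ih =>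
    obtain ⟨B₁, h1, h2⟩ := h
    rw [actions_cons, fresh_cons] at hf
    obtain ⟨K', h3, rfl, h4⟩ := h1.exists_weak hf.1
    obtain ⟨L, hL⟩ := ih h2 (h4 ▸ hf.2)
    exact ⟨L, K', h3, hL⟩

theorem Supported.finiteCont {φ : Finset Name} {K : St} (h : Supported φ K) : FiniteCont K := by
  refine Set.Finite.subset (φ.finite_toSet.preimage (f := Name.cont) ?_) fun q hq => ?_
  · intro a _ b _ hab
    cases hab
    rfl
  · obtain ⟨⟨E, r⟩, hE⟩ := Option.ne_none_iff_exists'.1 hq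
    exact (h.cont _ _ _ hE).1

theorem Supported.pend_eq_zero {φ : Set Name} {K : St} (h : Supported φ K) {r : Cont}
    (hr : Name.cont r ∉ φ) : K.pend r = 0 := by
  classical
  rw [St.pend_eq]
  have h1 : K.thr r = none := by
    by_contra hc
    exact hr (h.thr _ hc)
  have h2 : K.cont r = none := by
    by_contra hc
    obtain ⟨⟨E, p⟩, hE⟩ := Option.ne_none_iff_exists'.1 hc
    exact hr (h.cont _ _ _ hE).1
  have h3 : K.returning r = ∅ := by
    ext q
    simp only [St.returning, Set.mem_ofPred_eq, Set.mem_empty_iff_false, iff_false]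
    rintro ⟨E, hE⟩
    exact hr (h.cont _ _ _ hE).2
  simp [h1, h2, h3]

/-- Completeness becomes a condition on the final state, which is insensitive to the order of
events. -/
theorem CConf.complete_iff {K : CConf} (hK : Supported K.supp K.toSt) (s : Trace) :
    K.Complete s ↔ Fresh K.supp s ∧ Completes K.toSt s := by
  have key : ∀ es B', Run K.toSt es B' → Fresh K.supp (actions es) →
      ((actions es).AnswersAll K.pending ↔ Terminal B') := by
    intro es B' h1 h2
    rw [← St.pend_eq_zero_iff, K.pending_eq]
    exact answersAll_iff h2.1 (fun r hr => hK.pend_eq_zero (h2.2 _ hr))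
      (h1.pend_add hK.finiteCont)
  constructor
  · rintro ⟨⟨K', h1⟩, h2⟩
    obtain ⟨es, B', rfl, h4, h5⟩ := (Lag.refl K.toSt).run hK h1
    exact ⟨h5, es, B', rfl, h4, (key _ _ h4 h5).1 h2⟩
  · rintro ⟨h1, es, B', rfl, h2, h3⟩
    exact ⟨h2.hasTrace h1, (key _ _ h2 h1).2 h3⟩

/-! Alternating OGS as the alternating part of Concurrent OGS. -/

/-- Player is to move. -/
def AConf.isActive : AConf → Bool
  | .active _ _ _ _ => true
  | _ => false

theorem AConf.running_toC (F : AConf) : F.toC.running = F.running := by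
  cases F with
  | active M p γ φ =>
    ext q
    simp only [toC, CConf.running, running, Function.update_apply, Set.mem_ofPred_eq,
      Set.mem_singleton_iff]
    split_ifs with h <;> simp [h]
  | passive => simp [toC, CConf.running, running]
  | init => rfl

theorem AConf.env_toC (F : AConf) : F.toC.env = F.env := by cases F <;> rfl

theorem AConf.supp_toC (F : AConf) : F.toC.supp = F.supp := by cases F <;> rfl

theorem AConf.pending_toC (F : AConf) : F.toC.pending = F.pending := by
  rw [CConf.pending, F.running_toC, F.env_toC]; rfl

theorem AStep.toC {F F' : AConf} {l : Option Action} (h : AStep F l F') :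
    CStep F.toC l F'.toC ∧ (∀ a ∈ l, a.IsPlayer = F.isActive) ∧
      F'.isActive = xor F.isActive l.isSome := by
  cases h with
  | @tau M N p γ φ h =>
    refine ⟨?_, by simp, rfl⟩
    have := CStep.tau (A := Function.update (fun _ => none) p (some M)) (γ := γ) (φ := φ)
      (p := p) (by simp) h
    rwa [Function.update_idem] at this
  | @PA V p γ φ x h =>
    refine ⟨?_, by simp [Action.IsPlayer, AConf.isActive], rfl⟩
    have := CStep.PA (A := Function.update (fun _ => none) p (some V.1)) (γ := γ) (φ := φ)
      (p := p) (V := V) (by simp) h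
    rwa [Function.update_idem, Function.update_eq_self] at this
  | @PQ E x V p γ φ y q h1 h2 =>
    refine ⟨?_, by simp [Action.IsPlayer, AConf.isActive], rfl⟩
    have := CStep.PQ (A := Function.update (fun _ => none) p
      (some (E.plug (.app (.fvar x) V.1)))) (γ := γ) (φ := φ) (p := p)
      (E := E) (x := x) (V := V) (by simp) h1 h2
    rwa [Function.update_idem, Function.update_eq_self] at this
  | OA h1 h2 =>
    exact ⟨.OA h1 rfl h2, by simp [Action.IsPlayer, AConf.isActive], rfl⟩
  | OQ h1 h2 h3 =>
    exact ⟨.OQ h1 h2 h3, by simp [Action.IsPlayer, AConf.isActive], rfl⟩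
  | IOQ h1 =>
    exact ⟨.IOQ h1, by simp [Action.IsPlayer, AConf.isActive], rfl⟩

/-- At most one thread runs, so the polarity condition on the label is exactly the missing
alternation. -/
theorem AConf.step_of_toC {F : AConf} {K : CConf} {l : Option Action} (h : CStep F.toC l K)
    (hl : ∀ a ∈ l, a.IsPlayer = F.isActive) : ∃ F', AStep F l F' ∧ F'.toC = K := by
  have hup : ∀ (p q : Cont) (M N : Tm 0),
      Function.update (fun _ => none : Running) p (some M) q = some N → q = p ∧ N = M := by
    intro p q M N h
    rw [Function.update_apply] at h
    split_ifs at h with hq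
    exact ⟨hq, (Option.some.inj h).symm⟩
  cases F with
  | active M p γ φ =>
    cases h with
    | tau h1 h2 =>
      obtain ⟨rfl, rfl⟩ := hup _ _ _ _ h1
      exact ⟨_, .tau h2, by simp [toC]⟩
    | PA h1 h2 =>
      obtain ⟨rfl, rfl⟩ := hup _ _ _ _ h1
      exact ⟨_, .PA h2, by simp [toC]⟩
    | PQ h1 h2 h3 =>
      obtain ⟨rfl, rfl⟩ := hup _ _ _ _ h1
      exact ⟨_, .PQ h2 h3, by simp [toC]⟩
    | OA => simp [Action.IsPlayer, isActive] at hl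
    | OQ => simp [Action.IsPlayer, isActive] at hl
  | passive γ φ =>
    cases h with
    | tau h1 h2 => cases h1
    | PA h1 h2 => cases h1
    | PQ h1 h2 h3 => cases h1
    | OA h1 h2 h3 => exact ⟨_, .OA h1 h3, rfl⟩
    | OQ h1 h2 h3 => exact ⟨_, .OQ h1 h2 h3, rfl⟩
  | init M φ =>
    cases h with
    | IOQ h1 => exact ⟨_, .IOQ h1, rfl⟩

theorem AConf.tauStar_toC {F F' : AConf} (h : TauStar AStep F F') :
    TauStar CStep F.toC F'.toC ∧ F'.isActive = F.isActive := by
  induction h with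
  | refl => exact ⟨.refl, rfl⟩
  | tail _ h2 ih =>
    obtain ⟨h3, -, h4⟩ := h2.toC
    exact ⟨ih.1.tail h3, by simpa [ih.2] using h4⟩

theorem AConf.tauStar_of_toC {F : AConf} {K : CConf} (h : TauStar CStep F.toC K) :
    ∃ F', TauStar AStep F F' ∧ F'.toC = K := by
  induction h with
  | refl => exact ⟨F, .refl, rfl⟩
  | tail _ h2 ih =>
    obtain ⟨F₁, h3, rfl⟩ := ih
    obtain ⟨F', h4, rfl⟩ := step_of_toC h2 (by simp)
    exact ⟨F', h3.tail h4, rfl⟩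

theorem AConf.hasTrace_iff (F : AConf) (s : Trace) :
    HasTrace AStep F s ↔ HasTrace CStep F.toC s ∧ ∃ b, AltTrace F.isActive s b := by
  induction s generalizing F with
  | nil => exact ⟨fun _ => ⟨⟨_, rfl⟩, _, rfl⟩, fun _ => ⟨_, rfl⟩⟩
  | cons a s ih =>
    constructor
    · rintro ⟨F', F₃, ⟨F₁, F₂, h1, h2, h3⟩, h4⟩
      obtain ⟨h1, e1⟩ := tauStar_toC h1
      obtain ⟨h2, e2, e2'⟩ := h2.toC
      obtain ⟨h3, e3⟩ := tauStar_toC h3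
      obtain ⟨⟨K, h5⟩, b, h6⟩ := (ih F₃).1 ⟨F', h4⟩
      refine ⟨⟨K, _, ⟨_, _, h1, h2, h3⟩, h5⟩, b, ?_, ?_⟩
      · rw [← e1]; exact e2 a rfl
      · rw [e3, e2', e1] at h6
        simpa using h6
    · rintro ⟨⟨K, K₃, ⟨K₁, K₂, h1, h2, h3⟩, h4⟩, b, h5, h6⟩
      obtain ⟨F₁, h1', rfl⟩ := tauStar_of_toC h1
      have e1 := (tauStar_toC h1').2
      obtain ⟨F₂, h2', rfl⟩ := step_of_toC h2 (by simpa [e1] using h5)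
      have e2 := h2'.toC.2.2
      obtain ⟨F₃, h3', rfl⟩ := tauStar_of_toC h3
      have e3 := (tauStar_toC h3').2
      obtain ⟨F', h7⟩ := (ih F₃).2 ⟨⟨K, h4⟩, b, by rw [e3, e2, e1]; simpa using h6⟩
      exact ⟨F', F₃, ⟨F₁, F₂, h1', h2', h3'⟩, h7⟩

theorem AConf.complete_iff (F : AConf) (s : Trace) :
    F.Complete s ↔ F.toC.Complete s ∧ ∃ b, AltTrace F.isActive s b := by
  rw [Complete, CConf.Complete, hasTrace_iff, pending_toC]
  tauto

/-! Well-Bracketed OGS as the well-bracketed part of Alternating OGS. -/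

theorem WBStep.erase {F F' : WBConf} {l : Option Action} (h : WBStep F l F') :
    AStep F.erase l F'.erase := by
  cases h with
  | tau h => exact .tau h
  | PA h => exact .PA h
  | PQ h1 h2 => exact .PQ h1 h2
  | OA h1 h2 => exact .OA h1 h2
  | OQ h1 h2 h3 => exact .OQ h1 h2 h3
  | IOQ h => exact .IOQ h

theorem WBConf.tau_of_erase {F : WBConf} {K : AConf} (h : AStep F.erase none K) :
    ∃ F', WBStep F none F' ∧ F'.erase = K ∧ F'.stack = F.stack := by
  cases F with
  | active M p σ γ φ => cases h with | tau h => exact ⟨_, .tau h, rfl, rfl⟩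
  | passive => cases h
  | init => cases h

/-- The only restriction that the stack adds to a step is that an Opponent answer be on its top, as
the pushdown step provides. -/
theorem WBConf.step_of_erase {F : WBConf} {K : AConf} {a : Action} {σ' : Stack}
    (h : AStep F.erase (some a) K) (hσ : PushdownStep F.stack a σ') :
    ∃ F', WBStep F (some a) F' ∧ F'.erase = K ∧ F'.stack = σ' := by
  cases F with
  | active M p σ γ φ =>
    generalize he : (WBConf.active M p σ γ φ).erase = F₀ at h
    cases h with
    | PA h => cases he; cases hσ; exact ⟨_, .PA h, rfl, rfl⟩
    | PQ h1 h2 => cases he; cases hσ; exact ⟨_, .PQ h1 h2, rfl, rfl⟩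
    | OA => cases he
    | OQ => cases he
    | IOQ => cases he
  | passive σ γ φ =>
    cases h with
    | OA h1 h2 =>
      generalize hs : (WBConf.passive σ γ φ).stack = τ at hσ
      cases hσ
      obtain rfl : σ = _ := hs
      exact ⟨_, .OA h1 h2, rfl, rfl⟩
    | OQ h1 h2 h3 => cases hσ; exact ⟨_, .OQ h1 h2 h3, rfl, rfl⟩
  | init M φ =>
    cases h with
    | IOQ h => cases hσ; exact ⟨_, .IOQ h, rfl, rfl⟩

theorem WBConf.tauStar_erase {F F' : WBConf} (h : TauStar WBStep F F') :
    TauStar AStep F.erase F'.erase := by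
  induction h with
  | refl => exact .refl
  | tail _ h2 ih => exact ih.tail h2.erase

theorem WBConf.tauStar_of_erase {F : WBConf} {K : AConf} (h : TauStar AStep F.erase K) :
    ∃ F', TauStar WBStep F F' ∧ F'.erase = K ∧ F'.stack = F.stack := by
  induction h with
  | refl => exact ⟨F, .refl, rfl, rfl⟩
  | tail _ h2 ih =>
    obtain ⟨F₁, h3, rfl, e⟩ := ih
    obtain ⟨F', h4, rfl, e'⟩ := tau_of_erase h2
    exact ⟨F', h3.tail h4, rfl, e'.trans e⟩

theorem WBConf.hasTrace_erase {F : WBConf} {s : Trace} (h : HasTrace WBStep F s) :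
    HasTrace AStep F.erase s := by
  induction s generalizing F with
  | nil => exact ⟨_, rfl⟩
  | cons a s ih =>
    obtain ⟨F', F₃, ⟨F₁, F₂, h1, h2, h3⟩, h4⟩ := h
    obtain ⟨K, hK⟩ := ih ⟨F', h4⟩
    exact ⟨K, _, ⟨_, _, tauStar_erase h1, h2.erase, tauStar_erase h3⟩, hK⟩

theorem WBConf.hasTrace_of_erase {F : WBConf} {s : Trace} {σ : Stack}
    (h : HasTrace AStep F.erase s) (hσ : PushdownTrace F.stack s σ) : HasTrace WBStep F s := by
  induction s generalizing F with
  | nil => exact ⟨_, rfl⟩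
  | cons a s ih =>
    obtain ⟨K, K₃, ⟨K₁, K₂, h1, h2, h3⟩, h4⟩ := h
    obtain ⟨σ₁, h5, h6⟩ := hσ
    obtain ⟨F₁, h1', rfl, e1⟩ := tauStar_of_erase h1
    obtain ⟨F₂, h2', rfl, e2⟩ := step_of_erase h2 (e1 ▸ h5)
    obtain ⟨F₃, h3', rfl, e3⟩ := tauStar_of_erase h3
    obtain ⟨F', h7⟩ := ih ⟨K, h4⟩ (by rwa [e3, e2])
    exact ⟨F', F₃, ⟨F₁, F₂, h1', h2', h3'⟩, h7⟩

theorem WBConf.complete_iff (F : WBConf) (s : Trace) :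
    F.Complete s ↔ F.erase.Complete s ∧ PushdownTrace F.stack s [] :=
  ⟨fun h => ⟨⟨hasTrace_erase h.1, h.2.2⟩, h.2.1⟩,
    fun h => ⟨hasTrace_of_erase h.1.1 h.2, h.2, h.1.2⟩⟩

/-! Validity and support-equivalence. -/

theorem mem_supp_of_polarity {D : Set Name} {T : Set Cont} {γ : Env} {φ : Finset Name} {a : Name}
    (h : polarityOf D T γ φ a = some .O) : a ∈ φ ∧ a ∉ D := by
  unfold polarityOf at h
  split_ifs at h with h1 h2
  · simp at h
  · exact ⟨h2.1, h1⟩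

theorem AConf.Valid.running_isOName {F : AConf} (h : F.Valid) {p : Cont} (hp : p ∈ F.running) :
    F.IsOName (.cont p) := by
  cases F with
  | active M q γ φ =>
    obtain rfl : p = q := hp
    exact h.2.2.2
  | passive => exact hp.elim
  | init => exact hp.elim

theorem AConf.Valid.supported {F : AConf} (h : F.Valid) :
    Supported (F.toC.supp : Set Name) F.toC.toSt := by
  have hv : F.toC.toSt.val = F.env.val := by cases F <;> rfl
  have hc : F.toC.toSt.cont = F.env.cont := by cases F <;> rfl
  have ht : ∀ p, F.toC.toSt.thr p ≠ none → p ∈ F.running := by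
    intro p hp
    rw [← F.running_toC]
    cases F with
    | init => exact absurd rfl hp
    | active => exact Option.ne_none_iff_exists'.1 hp
    | passive => exact Option.ne_none_iff_exists'.1 hp
  rw [F.supp_toC]
  refine ⟨fun p hp => ?_, fun x hx => ?_, fun q E p hq => ⟨?_, ?_⟩⟩
  · exact (mem_supp_of_polarity (h.running_isOName (ht p hp))).1
  · rw [hv] at hx
    obtain ⟨V, hV⟩ := Option.ne_none_iff_exists'.1 hx
    exact h.1 (.inl ⟨x, V, rfl, hV⟩)
  · rw [hc] at hq
    exact h.1 (.inr ⟨q, _, rfl, hq⟩)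
  · rw [hc] at hq
    exact (mem_supp_of_polarity (h.2.1 _ (.inr ⟨q, E, p, hq, .inr rfl⟩))).1

theorem WBConf.Valid.wbState {F : WBConf} (h : F.Valid) :
    WBState (F.erase.supp : Set Name) F.erase.toC.toSt F.erase.isActive F.stack := by
  have hs := h.1.supported
  rw [AConf.supp_toC] at hs
  have hc : F.erase.toC.toSt.cont = F.erase.env.cont := by cases F <;> rfl
  refine ⟨hs, h.2.1, fun q => ?_, ?_, ?_⟩
  · rw [h.2.2, hc, Option.ne_none_iff_exists']
    simp [Env.dom]
  · cases F with
    | active => intro h; cases h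
    | passive => exact fun _ _ => rfl
    | init => exact fun _ _ => rfl
  · cases F with
    | active M p σ γ φ =>
      refine fun _ => ⟨p, ?_, fun r hr => ?_⟩
      · simp [erase, AConf.toC, CConf.toSt]
      · simp only [erase, AConf.toC, CConf.toSt, Function.update_apply] at hr
        by_contra hc
        simp [hc] at hr
    | passive => intro h; cases h
    | init => intro h; cases h

theorem AConf.isActive_eq_of_running {F G : AConf} (h : F.running = G.running) :
    F.isActive = G.isActive := by
  have key : ∀ F : AConf, F.isActive = true ↔ F.running.Nonempty := by
    intro F
    cases F <;> simp [isActive, running]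
  rw [Bool.eq_iff_iff, key, key, h]

theorem AConf.sameShape {F G : AConf} (h : F.contStructure = G.contStructure) :
    SameShape F.toC.toSt G.toC.toSt := by
  obtain ⟨h1, h2⟩ := Prod.mk.inj h
  have ht : ∀ (F : AConf) p, F.toC.toSt.thr p = none ↔ p ∉ F.running := by
    intro F p
    rw [← F.running_toC]
    cases F <;> simp [toC, CConf.toSt, CConf.running, Option.eq_none_iff_forall_ne_some]
  have hc : ∀ (F : AConf) q p,
      (F.toC.toSt.cont q).map Prod.snd = some p ↔ (q, p) ∈ F.env.cs := by
    intro F q p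
    have : F.toC.toSt.cont = F.env.cont := by cases F <;> rfl
    rw [this]
    simp [Env.cs]
  refine ⟨fun p => by rw [ht, ht, h1], fun q => Option.ext fun p => ?_⟩
  have := hc F q p
  rw [h2, ← hc G] at this
  exact this

/-- The two polarity functions differ only at running continuation names, which are O-names in the
Alternating reading by validity and P-names in the Concurrent one. Both configurations have the same
running names. -/
theorem AConf.supportEquiv_toC {F G : AConf} (hF : F.Valid) (hG : G.Valid) :
    F.SupportEquiv G ↔ F.toC.SupportEquiv G.toC := by
  have hcs : ∀ F : AConf, F.toC.contStructure = F.contStructure := by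
    intro F
    rw [CConf.contStructure, F.running_toC, F.env_toC]; rfl
  have hpol : ∀ (F : AConf) (a : Name), (∀ p ∈ F.running, a ≠ .cont p) →
      F.toC.polarity a = F.polarity a := by
    intro F a ha
    rw [CConf.polarity, F.running_toC, F.env_toC, F.supp_toC, polarity]
    have : a ∉ Name.cont '' F.running := by
      rintro ⟨p, hp, rfl⟩
      exact ha p hp rfl
    have hiff : a ∈ F.env.dom ∪ Name.cont '' F.running ↔ a ∈ F.env.dom :=
      ⟨fun h => h.resolve_right this, .inl⟩
    unfold polarityOf
    by_cases h1 : a ∈ F.env.dom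
    · rw [if_pos h1, if_pos (hiff.2 h1)]
    · rw [if_neg h1, if_neg (mt hiff.1 h1)]
  have hpol' : ∀ (F : AConf) (p : Cont), p ∈ F.running →
      F.toC.polarity (.cont p) = some .P := by
    intro F p hp
    rw [CConf.polarity, F.running_toC]
    exact if_pos (.inr ⟨p, hp, rfl⟩)
  rw [SupportEquiv, CConf.SupportEquiv, hcs, hcs]
  refine and_congr_left fun h => ?_
  have hr : F.running = G.running := (Prod.mk.inj h).1
  constructor
  · intro hp
    funext a
    by_cases ha : ∀ p ∈ F.running, a ≠ .cont p
    · rw [hpol F a ha, hpol G a (hr ▸ ha), hp]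
    · push Not at ha
      obtain ⟨p, hpr, rfl⟩ := ha
      rw [hpol' F p hpr, hpol' G p (hr ▸ hpr)]
  · intro hp
    funext a
    by_cases ha : ∀ p ∈ F.running, a ≠ .cont p
    · rw [← hpol F a ha, ← hpol G a (hr ▸ ha), hp]
    · push Not at ha
      obtain ⟨p, hpr, rfl⟩ := ha
      exact (hF.running_isOName hpr).trans (hG.running_isOName (hr ▸ hpr)).symm

/-- If the complete traces of `F` in WB-OGS are traces of `G`, so are those in Concurrent OGS. -/
theorem WBConf.complete_toC_of_complete {F G : WBConf} (hF : F.Valid) (hG : G.Valid)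
    (hcs : F.erase.contStructure = G.erase.contStructure)
    (h : ∀ s : Trace, (∀ a ∈ s.bound, a ∉ F.erase.supp ∧ a ∉ G.erase.supp) →
      F.Complete s → G.Complete s)
    {s : Trace} (hs : ∀ a ∈ s.bound, a ∉ F.erase.supp ∧ a ∉ G.erase.supp)
    (hc : F.erase.toC.Complete s) : G.erase.toC.Complete s := by
  have hmode := AConf.isActive_eq_of_running (Prod.mk.inj hcs).1
  rw [CConf.complete_iff hF.1.supported] at hc
  rw [CConf.complete_iff hG.1.supported]
  -- Taking both supports makes freshness for `φ` mean freshness for both configurations.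
  set φ : Set Name := ↑F.erase.supp ∪ ↑G.erase.supp with hφ
  have hincl : WBIncl φ F.erase.isActive F.stack F.erase.toC.toSt G.erase.toC.toSt := by
    intro s hs ⟨hb, hσ⟩ hc
    have := h s (fun a ha => by simpa [hφ] using hs.2 a ha)
    rw [complete_iff, complete_iff, AConf.complete_iff, AConf.complete_iff,
      CConf.complete_iff hF.1.supported, CConf.complete_iff hG.1.supported] at this
    refine (this ⟨⟨⟨?_, hc⟩, hb⟩, hσ⟩).1.1.2
    rw [AConf.supp_toC]
    exact hs.mono Set.subset_union_left
  have hfr : Fresh φ s := ⟨hc.1.1, fun a ha => by simpa [hφ] using hs a ha⟩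
  obtain ⟨es, K, rfl, h1, h2⟩ := hc.2
  obtain ⟨L, h3, h4⟩ := hincl.run_of_run (hF.wbState.mono Set.subset_union_left)
    (AConf.sameShape hcs) hfr h1 h2
  refine ⟨?_, es, L, rfl, h3, h4⟩
  rw [AConf.supp_toC]
  exact hfr.mono Set.subset_union_right

end OGS

theorem theoremt (F G : OGS.WBConf) (hF : F.Valid) (hG : G.Valid)
    (hstack : F.stack = G.stack) :
    (F.CompleteTraceEquiv G ↔ F.erase.CompleteTraceEquiv G.erase) ∧
      (F.erase.CompleteTraceEquiv G.erase ↔ F.erase.toC.CompleteTraceEquiv G.erase.toC) := by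
  have hWC : F.CompleteTraceEquiv G → F.erase.toC.CompleteTraceEquiv G.erase.toC := by
    rintro ⟨⟨h1, -⟩, h2⟩
    refine ⟨(OGS.AConf.supportEquiv_toC hF.1 hG.1).1 h1, fun s hs => ?_⟩
    rw [OGS.AConf.supp_toC, OGS.AConf.supp_toC] at hs
    exact ⟨OGS.WBConf.complete_toC_of_complete hF hG h1.2 (fun s hs => (h2 s hs).1) hs,
      OGS.WBConf.complete_toC_of_complete hG hF h1.2.symm
        (fun s hs => (h2 s fun a ha => (hs a ha).symm).2) fun a ha => (hs a ha).symm⟩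
  have hCA : F.erase.toC.CompleteTraceEquiv G.erase.toC →
      F.erase.CompleteTraceEquiv G.erase := by
    rintro ⟨h1, h2⟩
    have h3 := (OGS.AConf.supportEquiv_toC hF.1 hG.1).2 h1
    refine ⟨h3, fun s hs => ?_⟩
    -- Equal running names give the same player to move, hence the same alternation condition on
    -- both sides.
    rw [OGS.AConf.complete_iff, OGS.AConf.complete_iff,
      OGS.AConf.isActive_eq_of_running (Prod.mk.inj h3.2).1,
      h2 s (by simpa [OGS.AConf.supp_toC] using hs)]
  have hAW : F.erase.CompleteTraceEquiv G.erase → F.CompleteTraceEquiv G := by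
    rintro ⟨h1, h2⟩
    refine ⟨⟨h1, hstack⟩, fun s hs => ?_⟩
    rw [OGS.WBConf.complete_iff, OGS.WBConf.complete_iff, h2 s hs, hstack]
  exact ⟨⟨fun h => hCA (hWC h), hAW⟩, ⟨fun h => hWC (hAW h), hCA⟩⟩
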